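/- Let $\sigma$ be the substitution $a\to ab$, $b\to cb$, $c\to ad$, $d\to cd$, acting on bi-infinite words $w=(w_n)_{n\in\mathbb Z}$ with the seamline between the positions $-1$ and $0$ (so $\sigma(w)_{2n}\,\sigma(w)_{2n+1}=\sigma(w_n)$). There are precisely two bi-infinite words $w$ with $\sigma(w)=w$, namely the limits $w_1$ and $w_2$ of the iterations of $\sigma$ on the seeds $b|a$ and $d|a$, respectively. For a word $w$ and a letter $x$ put $\Omega_x=\Omega_x(w)=\{n\in\mathbb Z : w_n=x\}$. (1) Put $U_b=\bigcup_{m\ge 1}(2^{m+2}\mathbb Z+2^m-1)$ and $U_d=\bigcup_{m\ge 1}(2^{m+2}\mathbb Z+3\cdot 2^m-1)$. For both words, $\Omega_a=4\mathbb Z$ and $\Omega_c=4\mathbb Z+2$. For $w_1$, $\Omega_b=U_b\cup\{-1\}$ and $\Omega_d=U_d$; for $w_2$, $\Omega_b=U_b$ and $\Omega_d=U_d\cup\{-1\}$. (2) The lattice $\tilde L=\{(m,m) : m\in\mathbb Z\}\subset\mathbb R\times\mathbb Z_2$, where $\mathbb Z_2$ denotes the $2$-adic integers, defines a cut and project scheme: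 $\tilde L$ is a discrete closed subgroup, $(\mathbb R\times\mathbb Z_2)/\tilde L$ is compact, the projection of $\tilde L$ to $\mathbb R$ is one-to-one, and its projection to $\mathbb Z_2$ is dense. For $W\subset\mathbb Z_2$ put $\Lambda(W)=\{m\in\mathbb Z : m\in W\}$; this is a regular model set if $W$ is relatively compact, has non-empty interior, and has a boundary of Haar measure $0$. Let $W_x$ be the closure of $\Omega_x$ in $\mathbb Z_2$. For $w_1$ one has $\Omega_a=\Lambda(W_a)$, $\Omega_b=\Lambda(W_b)$, $\Omega_c=\Lambda(W_c)$ and $\Omega_d=\Lambda(W_d\setminus\{-1\})$; for $w_2$ one has $\Omega_a=\Lambda(W_a)$, $\Omega_b=\Lambda(W_b\setminus\{-1\})$, $\Omega_c=\Lambda(W_c)$ and $\Omega_d=\Lambda(W_d)$. All of these are regular model sets with the windows shown. (3) For $w\in\{w_1,w_2\}$ and $A,B,C,D\in\mathbb C$, let $\omega=A\,\delta_{\Omega_a}+B\,\delta_{\Omega_b}+C\,\delta_{\Omega_c}+D\,\delta_{\Omega_d}$, where $\delta_S=\sum_{x\in S}\delta_x$. Let $\omega_n$ be the restriction of $\omega$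 to $B_n=(-n,n)$, and let $\tilde\mu(f)=\overline{\mu(\tilde f)}$ with $\tilde f(x)=\overline{f(-x)}$. Then the autocorrelation $\gamma_\omega=\lim_{n\to\infty}\operatorname{vol}(B_n)^{-1}\,\omega_n*\tilde\omega_n$ exists in the vague topology, and its Fourier transform is the pure point measure $$\hat\gamma_\omega=\left|\tfrac{A+B+C+D}{4}\right|^2\delta_{\mathbb Z}+\sum_{m\ \mathrm{odd}}\left[\left|\tfrac{A-B+C-D}{4}\right|^2\delta_{m/2}+\left|\tfrac{A-C}{4}\right|^2\delta_{m/4}+\sum_{r\ge 3}\left|\tfrac{B-D}{2^r}\right|^2\delta_{m/2^r}\right],$$ where $m$ runs through all positive and negative odd integers. (4) Let $u$ be the binary reduction of $w\in\{w_1,w_2\}$ by $a,b\mapsto 1$ and $c,d\mapsto 0$, and put $\Omega_i=\{n : u_n=i\}$. Put $V_1=\bigcup_{m\ge 0}(2^{m+2}\mathbb Z+2^m-1)$ and $V_0=\bigcup_{m\ge 0}(2^{m+2}\mathbb Z+3\cdot 2^m-1)$. For $w_1$, $\Omega_1=V_1\cup\{-1\}$ and $\Omega_0=V_0$; for $w_2$,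 $\Omega_1=V_1$ and $\Omega_0=V_0\cup\{-1\}$. All of these are regular model sets in the above scheme; the window of $\Omega_i$ is the $2$-adic closure of $\Omega_i$, with the point $-1$ removed in those cases where $-1\notin\Omega_i$. For all $A,C\in\mathbb C$ the Dirac comb $A\,\delta_{\Omega_1}+C\,\delta_{\Omega_0}$ is pure point diffractive, with the diffraction measure of (3) for $B=A$ and $D=C$. -/

import Mathlib

open Set Filter Topology MeasureTheory
open scoped CompactlySupported FourierTransform Convolution ComplexConjugate

noncomputable section

/-! ### The substitution and its bi-infinite words -/

/-- The four-letter alphabet of the quaternary paperfolding sequences. -/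
inductive Letter : Type
  | a
  | b
  | c
  | d
  deriving DecidableEq

instance : Fintype Letter where
  elems := {.a, .b, .c, .d}
  complete x := by cases x <;> simp

/-- The substitution `a → ab`, `b → cb`, `c → ad`, `d → cd`. -/
def sigma : Letter → Letter × Letter
  | .a => (.a, .b)
  | .b => (.c, .b)
  | .c => (.a, .d)
  | .d => (.c, .d)

/-- Action of a substitution of constant length `2` on bi-infinite words. The seamline lies
between the positions `-1` and `0`, and the letter at position `n` is replaced by the two letters
at the positions `2 * n` and `2 * n + 1`. -/
def applySubst {α : Type*} (s : α → α × α) (w : ℤ → α) : ℤ → α := fun n =>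
  if Even n then (s (w (n / 2))).1 else (s (w (n / 2))).2

/-- `w` is the limit of the iteration of `s` on the seed `x|y`: for every `n`, the `n`-th iterate
of the two-letter word `x|y`, which occupies the positions `-2 ^ n, …, 2 ^ n - 1`,
is the central block of `w`. (The letters of `u` beyond the seed do not influence that block.) -/
def IsLimitOfSeed {α : Type*} (s : α → α × α) (x y : α) (w : ℤ → α) : Prop :=
  ∀ u : ℤ → α, u (-1) = x → u 0 = y → ∀ n : ℕ, ∀ i : ℤ, -2 ^ n ≤ i → i < 2 ^ n →
    (applySubst s)^[n] u i = w i

/-- The binary reduction: `a, b ↦ 1` and `c, d ↦ 0`. -/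
def binaryReduction : Letter → Fin 2
  | .a => 1
  | .b => 1
  | .c => 0
  | .d => 0

/-- The set of positions of type `x` in the word `w`. -/
def typeSet {α : Type*} (w : ℤ → α) (x : α) : Set ℤ := {n | w n = x}

/-- The set of points of type `x`, as a subset of the line. -/
def pointSet {α : Type*} (w : ℤ → α) (x : α) : Set ℝ := (fun n : ℤ => (n : ℝ)) '' typeSet w x

/-- The residue class `q ℤ + r`. -/
def residueClass (q r : ℤ) : Set ℤ := {n | ∃ k : ℤ, n = q * k + r}

/-! ### Cut and project schemes and model sets -/

/-- A cut and project scheme with physical space `ℝ` and internal space `H`. The group `L ⊆ ℝ` is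
given by an injective homomorphism `ι : L → ℝ`, and `star : L → H` is the star map. The group
`{(ι x, star x) | x ∈ L}` is required to be a lattice in `ℝ × H`. -/
structure IsCutAndProjectScheme {L H : Type*} [AddCommGroup L] [AddCommGroup H]
    [TopologicalSpace H] [IsTopologicalAddGroup H] [LocallyCompactSpace H] [T2Space H]
    (ι : L →+ ℝ) (star : L →+ H) : Prop where
  injective : Function.Injective ι
  denseRange : DenseRange star
  isClosed : IsClosed ((ι.prod star).range : Set (ℝ × H))
  discrete : DiscreteTopology (ι.prod star).range
  cocompact : CompactSpace ((ℝ × H) ⧸ (ι.prod star).range)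

/-- The set `Λ(W) = {x ∈ L | star x ∈ W}`, as a subset of `ℝ`. -/
def projectedSet {L H : Type*} [AddCommGroup L] [AddCommGroup H]
    (ι : L →+ ℝ) (star : L →+ H) (W : Set H) : Set ℝ :=
  ι '' (star ⁻¹' W)

/-- Haar measure on a locally compact Abelian group, on its Borel sets. -/
def borelHaar (H : Type*) [AddCommGroup H] [TopologicalSpace H] [IsTopologicalAddGroup H]
    [LocallyCompactSpace H] : @Measure H (borel H) :=
  letI : MeasurableSpace H := borel H
  haveI : BorelSpace H := ⟨rfl⟩
  Measure.addHaar

/-- `Λ` is the regular model set `t + Λ(W)` of the given cut and project scheme. -/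
structure IsRegularModelSet {L H : Type*} [AddCommGroup L] [AddCommGroup H]
    [TopologicalSpace H] [IsTopologicalAddGroup H] [LocallyCompactSpace H] [T2Space H]
    (ι : L →+ ℝ) (star : L →+ H) (t : ℝ) (W : Set H) (Λ : Set ℝ) : Prop where
  scheme : IsCutAndProjectScheme ι star
  relativelyCompact : IsCompact (closure W)
  interior_nonempty : (interior W).Nonempty
  frontier_null : borelHaar H (frontier W) = 0
  eq_translate : Λ = (fun x => t + x) '' projectedSet ι star W

/-- The embedding of `ℤ` into the line. -/
def physicalMap : ℤ →+ ℝ := Int.castAddHom ℝ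

/-- The embedding of `ℤ` into the `2`-adic integers. -/
def starMap : ℤ →+ ℤ_[2] := Int.castAddHom ℤ_[2]

/-- The `2`-adic closure of a set of integers. -/
def twoAdicClosure (S : Set ℤ) : Set ℤ_[2] := closure (starMap '' S)

/-! ### Diffraction of weighted Dirac combs on the line -/

/-- The weight function of the Dirac comb `∑ x, h x • δ_{Ω_x}`, where `Ω_x` is the set of points
of type `x` in the word `w`. -/
def combWeight {α : Type*} [Fintype α] (h : α → ℂ) (w : ℤ → α) : ℝ → ℂ := fun y =>
  ∑ x : α, (pointSet w x).indicator (fun _ => h x) y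

/-- The restriction to the ball of radius `n` around `0` of the Dirac comb `∑ x, v x • δ_x`, as a
functional. It is used for weights `v` with locally finite support, so that the sum is finite. -/
def restrictedComb (v : ℝ → ℂ) (n : ℕ) : (ℝ → ℂ) → ℂ := fun f =>
  ∑ᶠ x : ℝ, (Metric.ball (0 : ℝ) n).indicator v x * f x

/-- The functional `μ~`, given by `μ~ (f) = conj (μ (f~))` with `f~ x = conj (f (-x))`. -/
def tildeFunctional (μ : (ℝ → ℂ) → ℂ) : (ℝ → ℂ) → ℂ := fun f =>
  conj (μ fun x => conj (f (-x)))

/-- The convolution `(μ * ν) (f) = ∫∫ f (x + y) dμ(x) dν(y)` of two functionals. -/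
def convFunctional (μ ν : (ℝ → ℂ) → ℂ) : (ℝ → ℂ) → ℂ := fun f =>
  μ fun x => ν fun y => f (x + y)

/-- The finite-volume autocorrelation `(ω_n * ω_n~) / vol (B_n)` of the Dirac comb `ω` with
weights `v`. -/
def finiteAutocorrelation (v : ℝ → ℂ) (n : ℕ) (f : ℝ → ℂ) : ℂ :=
  convFunctional (restrictedComb v n) (tildeFunctional (restrictedComb v n)) f /
    (((volume (Metric.ball (0 : ℝ) n)).toReal : ℝ) : ℂ)

/-- A linear functional on compactly supported continuous functions is a complex measure if it is
continuous (for the inductive limit topology). -/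
def IsComplexRadon (γ : C_c(ℝ, ℂ) →ₗ[ℂ] ℂ) : Prop :=
  ∀ K : Set ℝ, IsCompact K → ∃ C : ℝ, ∀ f : C_c(ℝ, ℂ), tsupport f ⊆ K →
    ∀ M : ℝ, (∀ x, ‖f x‖ ≤ M) → ‖γ f‖ ≤ C * M

/-- The measure `γ` is the autocorrelation of the Dirac comb with weights `v`: it is the limit of
the finite-volume autocorrelations in the vague topology. -/
structure IsAutocorrelation (v : ℝ → ℂ) (γ : C_c(ℝ, ℂ) →ₗ[ℂ] ℂ) : Prop where
  isComplexRadon : IsComplexRadon γ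
  tendsto : ∀ f : C_c(ℝ, ℂ),
    Tendsto (fun n : ℕ => finiteAutocorrelation v n f) atTop (𝓝 (γ f))

/-- The function `g~ x = conj (g (-x))`. -/
def tildeFun (g : C_c(ℝ, ℂ)) : C_c(ℝ, ℂ) where
  toFun x := conj (g (-x))
  continuous_toFun := Complex.continuous_conj.comp (g.continuous.comp continuous_neg)
  hasCompactSupport' := by
    have h : HasCompactSupport fun x : ℝ => g (-x) :=
      g.hasCompactSupport.comp_homeomorph (Homeomorph.neg ℝ)
    exact h.comp_left (g := fun z : ℂ => conj z) (map_zero _)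

/-- The convolution `g * g~`, with `(g * g~) x = ∫ g y * g~ (x - y) dy`. -/
def selfConv (g : C_c(ℝ, ℂ)) : C_c(ℝ, ℂ) where
  toFun := g ⋆[ContinuousLinearMap.mul ℂ ℂ, volume] (tildeFun g)
  continuous_toFun :=
    (tildeFun g).hasCompactSupport.continuous_convolution_right _
      (g.continuous.locallyIntegrable) (tildeFun g).continuous
  hasCompactSupport' :=
    HasCompactSupport.convolution _ g.hasCompactSupport (tildeFun g).hasCompactSupport

/-- The positive Borel measure `ν` on `ℝ` is the Fourier transform of the (positive definite)
measure `γ`: for all continuous compactly supported `g`, the inverse Fourier transform of `g` is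
square integrable for `ν`, and `∫ |𝓕⁻ g|² dν = γ (g * g~)`. This characterises `ν` uniquely. -/
def IsFourierTransformOf (ν : Measure ℝ) (γ : C_c(ℝ, ℂ) →ₗ[ℂ] ℂ) : Prop :=
  ∀ g : C_c(ℝ, ℂ),
    Integrable (fun k : ℝ => ‖𝓕⁻ (fun x : ℝ => g x) k‖ ^ 2) ν ∧
      ((∫ k : ℝ, ‖𝓕⁻ (fun x : ℝ => g x) k‖ ^ 2 ∂ν : ℝ) : ℂ) = γ (selfConv g)

/-- The Dirac comb with weights `v` has an autocorrelation, with Fourier transform `ν`. -/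
def HasDiffraction (v : ℝ → ℂ) (ν : Measure ℝ) : Prop :=
  ∃ γ : C_c(ℝ, ℂ) →ₗ[ℂ] ℂ, IsAutocorrelation v γ ∧ IsFourierTransformOf ν γ

/-- A measure is pure point if it is concentrated on a countable set. -/
def IsPurePoint (ν : Measure ℝ) : Prop := ∃ S : Set ℝ, S.Countable ∧ ν Sᶜ = 0

/-- The Dirac comb with weights `v` has a diffraction measure, and it is pure point. -/
def IsPurePointDiffractive (v : ℝ → ℂ) : Prop :=
  ∃ ν : Measure ℝ, HasDiffraction v ν ∧ IsPurePoint ν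

/-- The weights `A, B, C, D` for the letters `a, b, c, d`. -/
def letterWeight (A B C D : ℂ) : Letter → ℂ
  | .a => A
  | .b => B
  | .c => C
  | .d => D

/-- The measure
`|(A+B+C+D)/4|² δ_ℤ + ∑_{m odd} (|(A-B+C-D)/4|² δ_{m/2} + |(A-C)/4|² δ_{m/4}
  + ∑_{r ≥ 3} |(B-D)/2^r|² δ_{m/2^r})`,
where `m` runs through all (positive and negative) odd integers. -/
def paperSpectrum (A B C D : ℂ) : Measure ℝ :=
  ENNReal.ofReal (‖(A + B + C + D) / 4‖ ^ 2) •
      Measure.sum (fun n : ℤ => Measure.dirac (n : ℝ)) +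
    Measure.sum (fun m : {m : ℤ // Odd m} =>
      ENNReal.ofReal (‖(A - B + C - D) / 4‖ ^ 2) • Measure.dirac ((m : ℤ) / 2 : ℝ) +
      ENNReal.ofReal (‖(A - C) / 4‖ ^ 2) • Measure.dirac ((m : ℤ) / 4 : ℝ) +
      Measure.sum (fun r : {r : ℕ // 3 ≤ r} =>
        ENNReal.ofReal (‖(B - D) / 2 ^ (r : ℕ)‖ ^ 2) •
          Measure.dirac ((m : ℤ) / 2 ^ (r : ℕ) : ℝ)))

end

/-! ### The fixed points of the substitution -/

/-! Write `n + 1 = 2 ^ m * (4 * k + s)` with `s = 1` or `s = 3` and call `s` the sign of `n`.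
Passing from `n` to `2 * n + 1` doubles `n + 1` and keeps the sign; the sign of `2 * n` is the
parity of `n`. Therefore the word that records parity and sign of each position is fixed by `sigma`
(`IsSignPattern.applySubst`). Only `-1` has no sign, and either value may be chosen there, because
`-1` is its own image under `n ↦ 2 * n + 1`. A fixed word is determined by its letters at `-1` and
`0` (`eq_of_fixed`), and these can only be `b|a` or `d|a` (`seed_of_fixed`); so there are exactly
two.

On the `2`-adic integers the sign is locally constant off `-1`: the two sign sets are open and
partition the complement of `-1`. The closure of a type set therefore adds at most the point `-1`,
which is Haar-null. This yields the windows and their null boundaries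
(`isRegularModelSet_of_window`).

For the diffraction, let the `r`-th wave be the function that alternates between `1` and `-1` on the
multiples of `2 ^ r` and vanishes elsewhere. Off `-1`, the weight of the letter at `x` is a constant
`d`, plus `c 0` times wave `0`, plus the sum over `j` of `c (j + 1)` times wave `j + 1` at `x + 1 -
2 ^ j`; only the term with `j = m` survives, and it carries the sign (`letterWeight_signWord`).
Shifted waves of different orders are orthogonal in the mean, and the correlation of a wave with
itself does not depend on its shift. So the autocorrelation has the coefficients `‖d‖ ^ 2 + ∑ ‖c r‖
^ 2 * 2 ^ (-r) * dyadicWave r m` (`hasMean_of_eq_wavePartialSum`), whatever the letter at `-1` is.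

Finally, `2 ^ r * dyadicWave r` is the difference of the combs `2 ^ (r + 1)` on the multiples of `2
^ (r + 1)` and `2 ^ r` on the multiples of `2 ^ r`. By Poisson summation its transform is the sum of
unit masses at the points `m / 2 ^ (r + 1)` with `m` odd (`exists_hasSum_fourierInv_odd`), so these
points receive the intensity `‖c r‖ ^ 2 / 4 ^ r`. -/

/-- The integers `n` for which the odd part of `n + 1` is congruent to `s` modulo `4`. -/
def signSet (s : ℤ) : Set ℤ := ⋃ m : ℕ, residueClass (2 ^ (m + 2)) (s * 2 ^ m - 1)

theorem mem_signSet {s n : ℤ} : n ∈ signSet s ↔ ∃ (m : ℕ) (k : ℤ), n + 1 = 2 ^ m * (4 * k + s) := by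
  simp only [signSet, residueClass, mem_iUnion, mem_ofPred_eq]
  refine exists_congr fun m => exists_congr fun k => ?_
  rw [show (2 : ℤ) ^ (m + 2) * k + (s * 2 ^ m - 1) = 2 ^ m * (4 * k + s) - 1 by ring]
  omega

theorem exists_eq_two_pow_mul_four_mul_add {y : ℤ} (hy : y ≠ 0) :
    ∃ (m : ℕ) (k s : ℤ), (s = 1 ∨ s = 3) ∧ y = 2 ^ m * (4 * k + s) := by
  obtain ⟨c, h, hc⟩ := ((Int.finiteMultiplicity_iff (a := 2) (b := y)).2
    ⟨by decide, hy⟩).exists_eq_pow_mul_and_not_dvd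
  refine ⟨multiplicity 2 y, c / 4, c % 4, by omega, ?_⟩
  rwa [Int.mul_ediv_add_emod]

theorem neg_one_notMem_signSet {s : ℤ} (hs : Odd s) : (-1 : ℤ) ∉ signSet s := by
  rw [mem_signSet]
  rintro ⟨m, k, h⟩
  obtain ⟨t, rfl⟩ := hs
  have h2 : (2 : ℤ) ^ m ≠ 0 := by positivity
  have h4 : 4 * k + (2 * t + 1) ≠ 0 := by omega
  exact mul_ne_zero h2 h4 (by omega)

theorem mem_signSet_one_or_three {n : ℤ} (hn : n ≠ -1) : n ∈ signSet 1 ∨ n ∈ signSet 3 := by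
  obtain ⟨m, k, s, rfl | rfl, h⟩ :=
    exists_eq_two_pow_mul_four_mul_add (y := n + 1) (by omega)
  · exact Or.inl (mem_signSet.2 ⟨m, k, h⟩)
  · exact Or.inr (mem_signSet.2 ⟨m, k, h⟩)

theorem two_pow_mul_odd_injective {m n : ℕ} {k l : ℤ} (hk : Odd k) (hl : Odd l)
    (h : (2 : ℤ) ^ m * k = 2 ^ n * l) : m = n ∧ k = l := by
  have key : ∀ {m n : ℕ} {k l : ℤ}, Odd k → (2 : ℤ) ^ m * k = 2 ^ n * l → n ≤ m := by
    intro m n k l hk h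
    by_contra! hlt
    obtain ⟨j, rfl⟩ := Nat.exists_eq_add_of_lt hlt
    have h2 : (2 : ℤ) ^ m ≠ 0 := by positivity
    have : k = 2 * (2 ^ j * l) := mul_left_cancel₀ h2 (by rw [h]; ring)
    obtain ⟨t, rfl⟩ := hk
    omega
  obtain rfl := le_antisymm (key hl h.symm) (key hk h)
  exact ⟨rfl, mul_left_cancel₀ (by positivity) h⟩

theorem disjoint_signSet : Disjoint (signSet 1) (signSet 3) := by
  rw [Set.disjoint_left]
  intro n h1 h3
  obtain ⟨m, k, h⟩ := mem_signSet.1 h1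
  obtain ⟨m', l, h'⟩ := mem_signSet.1 h3
  have := (two_pow_mul_odd_injective (by exact ⟨2 * k, by ring⟩) (by exact ⟨2 * l + 1, by ring⟩)
    (h.symm.trans h')).2
  omega

theorem mem_signSet_three_iff {n : ℤ} : n ∈ signSet 3 ↔ n ≠ -1 ∧ n ∉ signSet 1 := by
  constructor
  · intro h
    refine ⟨?_, fun h1 => Set.disjoint_left.1 disjoint_signSet h1 h⟩
    rintro rfl
    exact neg_one_notMem_signSet (by decide) h
  · rintro ⟨h, h1⟩
    exact (mem_signSet_one_or_three h).resolve_left h1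

theorem two_mul_mem_signSet_one {n : ℤ} : 2 * n ∈ signSet 1 ↔ Even n := by
  rw [mem_signSet]
  constructor
  · rintro ⟨m, k, h⟩
    rcases m with _ | m
    · exact ⟨k, by omega⟩
    · rw [pow_succ, mul_comm _ (2 : ℤ), mul_assoc] at h
      omega
  · rintro ⟨k, rfl⟩
    exact ⟨0, k, by ring⟩

theorem two_mul_add_one_mem_signSet {n s : ℤ} (hs : Odd s) :
    2 * n + 1 ∈ signSet s ↔ n ∈ signSet s := by
  simp only [mem_signSet]
  constructor
  · rintro ⟨m, k, h⟩
    rcases m with _ | m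
    · obtain ⟨t, rfl⟩ := hs
      omega
    · refine ⟨m, k, ?_⟩
      rw [pow_succ, mul_comm _ (2 : ℤ), mul_assoc] at h
      omega
  · rintro ⟨m, k, h⟩
    refine ⟨m + 1, k, ?_⟩
    rw [pow_succ, mul_comm _ (2 : ℤ), mul_assoc]
    omega

open Classical in
/-- The word whose letters at even positions are `a` on `P` and `c` off `P`, and whose letters at
odd positions are `b` on `P` and `d` off `P`. -/
noncomputable def signWord (P : Set ℤ) : ℤ → Letter := fun n =>
  if Even n then (if n ∈ P then .a else .c) else (if n ∈ P then .b else .d)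

/-- `P` agrees with `signSet 1` off `-1`; then the sign word of `P` is fixed by `sigma`. -/
def IsSignPattern (P : Set ℤ) : Prop := P \ {-1} = signSet 1

theorem IsSignPattern.mem_iff {P : Set ℤ} (hP : IsSignPattern P) {n : ℤ} (hn : n ≠ -1) :
    n ∈ P ↔ n ∈ signSet 1 := by
  rw [← show P \ {-1} = signSet 1 from hP]
  simp [hn]

/-- The first letter of `sigma x` is `a` or `c` according to whether `x` belongs to an even or an
odd position; the second letter copies the sign of `x`. This is how the signs of `2 * k` and `2 * k
+ 1` arise from `k`. -/
theorem IsSignPattern.applySubst {P : Set ℤ} (hP : IsSignPattern P) :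
    applySubst sigma (signWord P) = signWord P := by
  funext n
  obtain ⟨k, rfl | rfl⟩ := Int.even_or_odd' n
  · have h1 : 2 * k ∈ P ↔ Even k := by
      rw [hP.mem_iff (by omega), two_mul_mem_signSet_one]
    by_cases hk : Even k <;> by_cases hkP : k ∈ P <;>
      simp [_root_.applySubst, signWord, h1, hk, hkP, sigma]
  · have h1 : 2 * k + 1 ∈ P ↔ k ∈ P := by
      -- At `k = -1` both sides speak of the same position, so the choice made at `-1` is
      -- unconstrained.
      by_cases h : k = -1
      · subst h; simp
      · rw [hP.mem_iff h, hP.mem_iff (by omega), two_mul_add_one_mem_signSet odd_one]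
    have h2 : (2 * k + 1) / 2 = k := by omega
    have h3 : ¬ Even (2 * k + 1) := Int.not_even_two_mul_add_one k
    by_cases hk : Even k <;> by_cases hkP : k ∈ P <;>
      simp only [_root_.applySubst, signWord, h1, hk, hkP, sigma, h2, h3, if_true, if_false]

/-- The new letter at `i` depends only on the old letter at `⌊i / 2⌋`, and halving maps each central
block into the preceding one. -/
theorem iterate_applySubst_congr {α : Type*} (s : α → α × α) {u v : ℤ → α}
    (h₁ : u (-1) = v (-1)) (h₀ : u 0 = v 0) (n : ℕ) :
    ∀ i : ℤ, -2 ^ n ≤ i → i < 2 ^ n → (applySubst s)^[n] u i = (applySubst s)^[n] v i := by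
  induction n with
  | zero =>
    intro i hi hi'
    obtain rfl | rfl : i = -1 ∨ i = 0 := by simp at hi hi'; omega
    · exact h₁
    · exact h₀
  | succ n ih =>
    intro i hi hi'
    rw [pow_succ] at hi hi'
    have h := ih (i / 2) (by omega) (by omega)
    simp only [Function.iterate_succ_apply', applySubst, h]

theorem isLimitOfSeed_of_fixed {α : Type*} {s : α → α × α} {w : ℤ → α} (hw : applySubst s w = w) :
    IsLimitOfSeed s (w (-1)) (w 0) w := by
  intro u h₁ h₀ n i hi hi'
  rw [iterate_applySubst_congr s h₁ h₀ n i hi hi', Function.iterate_fixed hw]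

theorem eq_of_fixed {α : Type*} {s : α → α × α} {v w : ℤ → α} (hv : applySubst s v = v)
    (hw : applySubst s w = w) (h₁ : v (-1) = w (-1)) (h₀ : v 0 = w 0) : v = w := by
  funext i
  have hlt : (i.natAbs : ℤ) < 2 ^ i.natAbs := by exact_mod_cast Nat.lt_two_pow_self
  rw [← isLimitOfSeed_of_fixed hw v h₁ h₀ i.natAbs i (by omega) (by omega),
    Function.iterate_fixed hv]

/-- The letter at `-1` must be the second letter of its own image and the letter at `0` the first
letter of its own image. -/
theorem seed_of_fixed {w : ℤ → Letter} (hw : applySubst sigma w = w) :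
    (w (-1) = .b ∨ w (-1) = .d) ∧ w 0 = .a := by
  have h₁ := congrFun hw (-1)
  have h₀ := congrFun hw 0
  simp only [applySubst] at h₁ h₀
  norm_num at h₁ h₀
  constructor
  · revert h₁
    cases w (-1) <;> simp [sigma]
  · revert h₀
    cases w 0 <;> simp [sigma]

theorem zero_mem_signSet_one : (0 : ℤ) ∈ signSet 1 := mem_signSet.2 ⟨0, 0, by norm_num⟩

theorem isSignPattern_signSet : IsSignPattern (signSet 1) :=
  sdiff_singleton_eq_self (neg_one_notMem_signSet odd_one)

theorem isSignPattern_signSet_union : IsSignPattern (signSet 1 ∪ {-1}) := by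
  rw [IsSignPattern, union_sdiff_right]
  exact sdiff_singleton_eq_self (neg_one_notMem_signSet odd_one)

theorem signWord_zero {P : Set ℤ} (hP : IsSignPattern P) : signWord P 0 = .a := by
  have : (0 : ℤ) ∈ P := (hP.mem_iff (by norm_num)).2 zero_mem_signSet_one
  simp [signWord, this]

theorem signWord_neg_one_of_mem {P : Set ℤ} (h : (-1 : ℤ) ∈ P) : signWord P (-1) = .b := by
  simp [signWord, h]

theorem signWord_neg_one_of_notMem {P : Set ℤ} (h : (-1 : ℤ) ∉ P) : signWord P (-1) = .d := by
  simp [signWord, h]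

theorem setOf_fixed_eq :
    {w | applySubst sigma w = w} = {signWord (signSet 1 ∪ {-1}), signWord (signSet 1)} := by
  ext w
  simp only [mem_ofPred_eq, mem_insert_iff, mem_singleton_iff]
  constructor
  · intro hw
    obtain ⟨h | h, h₀⟩ := seed_of_fixed hw
    · refine Or.inl (eq_of_fixed hw isSignPattern_signSet_union.applySubst ?_ ?_)
      · rw [h, signWord_neg_one_of_mem (by simp)]
      · rw [h₀, signWord_zero isSignPattern_signSet_union]
    · refine Or.inr (eq_of_fixed hw isSignPattern_signSet.applySubst ?_ ?_)
      · rw [h, signWord_neg_one_of_notMem (neg_one_notMem_signSet odd_one)]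
      · rw [h₀, signWord_zero isSignPattern_signSet]
  · rintro (rfl | rfl)
    · exact isSignPattern_signSet_union.applySubst
    · exact isSignPattern_signSet.applySubst

/-! ### The type sets of the fixed points -/

theorem typeSet_signWord (P : Set ℤ) :
    typeSet (signWord P) .a = {n | Even n} ∩ P ∧ typeSet (signWord P) .b = {n | ¬ Even n} ∩ P ∧
      typeSet (signWord P) .c = {n | Even n} ∩ Pᶜ ∧
      typeSet (signWord P) .d = {n | ¬ Even n} ∩ Pᶜ := by
  refine ⟨?_, ?_, ?_, ?_⟩ <;> ext n <;> by_cases hn : Even n <;> by_cases hP : n ∈ P <;>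
    simp [typeSet, signWord, hn, hP, -Int.not_even_iff_odd]

theorem typeSet_binaryReduction_signWord (P : Set ℤ) :
    typeSet (binaryReduction ∘ signWord P) 1 = P ∧
      typeSet (binaryReduction ∘ signWord P) 0 = Pᶜ := by
  refine ⟨?_, ?_⟩ <;> ext n <;> by_cases hn : Even n <;> by_cases hP : n ∈ P <;>
    simp [typeSet, signWord, hn, hP, binaryReduction]

theorem even_inter_signSet_one : {n : ℤ | Even n} ∩ signSet 1 = residueClass 4 0 := by
  ext n
  simp only [mem_inter_iff, mem_ofPred_eq, residueClass]
  constructor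
  · rintro ⟨⟨k, rfl⟩, h⟩
    rw [← two_mul, two_mul_mem_signSet_one] at h
    obtain ⟨j, rfl⟩ := h
    exact ⟨j, by ring⟩
  · rintro ⟨k, rfl⟩
    have h : 4 * k + 0 = 2 * (2 * k) := by ring
    rw [h, two_mul_mem_signSet_one]
    exact ⟨even_two_mul _, even_two_mul _⟩

theorem even_diff_signSet_one : {n : ℤ | Even n} ∩ (signSet 1)ᶜ = residueClass 4 2 := by
  ext n
  simp only [mem_inter_iff, mem_ofPred_eq, residueClass, mem_compl_iff]
  constructor
  · rintro ⟨⟨k, rfl⟩, h⟩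
    rw [← two_mul, two_mul_mem_signSet_one, Int.not_even_iff_odd] at h
    obtain ⟨j, rfl⟩ := h
    exact ⟨j, by ring⟩
  · rintro ⟨k, rfl⟩
    have h : 4 * k + 2 = 2 * (2 * k + 1) := by ring
    rw [h, two_mul_mem_signSet_one]
    exact ⟨even_two_mul _, by simp⟩

theorem odd_inter_signSet (s : ℤ) (hs : Odd s) : {n : ℤ | ¬ Even n} ∩ signSet s =
    ⋃ m : ℕ, ⋃ _ : 1 ≤ m, residueClass (2 ^ (m + 2)) (s * 2 ^ m - 1) := by
  ext n
  simp only [signSet, mem_inter_iff, mem_ofPred_eq, mem_iUnion, residueClass, exists_prop]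
  obtain ⟨t, rfl⟩ := hs
  constructor
  · rintro ⟨hn, m, k, rfl⟩
    refine ⟨m, ?_, k, rfl⟩
    rcases m with _ | m
    · exact absurd ⟨2 * k + t, by ring⟩ hn
    · omega
  · rintro ⟨m, hm, k, rfl⟩
    refine ⟨?_, m, k, rfl⟩
    obtain ⟨j, rfl⟩ := Nat.exists_eq_add_of_le' hm
    rw [Int.not_even_iff_odd]
    exact ⟨2 ^ (j + 2) * k + (2 * t + 1) * 2 ^ j - 1, by ring⟩

theorem compl_signSet_one : (signSet 1)ᶜ = signSet 3 ∪ {-1} := by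
  ext n
  have := @mem_signSet_three_iff n
  have h1 := neg_one_notMem_signSet odd_one
  by_cases hn : n = -1
  · subst hn; simpa using h1
  · simp [this, hn]

theorem compl_signSet_one_union : (signSet 1 ∪ {-1})ᶜ = signSet 3 := by
  ext n
  rw [mem_signSet_three_iff]
  simp only [mem_compl_iff, mem_union, mem_singleton_iff]
  tauto

/-! ### The cut and project scheme -/

theorem isCutAndProjectScheme_padicInt : IsCutAndProjectScheme physicalMap starMap := by
  have hdisc : DiscreteTopology (physicalMap.prod starMap).range := by
    refine discreteTopology_of_isOpen_singleton_zero ?_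
    have hU : IsOpen {x : (physicalMap.prod starMap).range | |(x : ℝ × ℤ_[2]).1| < 1} :=
      isOpen_lt (by fun_prop) continuous_const
    convert hU using 1
    ext ⟨x, n, rfl⟩
    simp only [mem_singleton_iff, mem_ofPred_eq, Subtype.ext_iff]
    constructor
    · intro h
      simp [h]
    · intro h
      have hn : |(n : ℝ)| < 1 := h
      have hn0 : n = 0 := by
        have : |n| < 1 := by exact_mod_cast hn
        simpa using this
      subst hn0
      simp
  exact
    { injective := Int.cast_injective
      denseRange := PadicInt.denseRange_intCast
      isClosed := AddSubgroup.isClosed_of_discrete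
      discrete := hdisc
      cocompact := by
        -- Subtracting the lattice point `(⌊x⌋, ⌊x⌋)` moves every point into this compact set.
        have hK : IsCompact (Icc (0 : ℝ) 1 ×ˢ (univ : Set ℤ_[2])) := isCompact_Icc.prod isCompact_univ
        have himg := hK.image (f := (QuotientAddGroup.mk :
          ℝ × ℤ_[2] → (ℝ × ℤ_[2]) ⧸ (physicalMap.prod starMap).range)) continuous_quotient_mk'
        refine ⟨himg.of_isClosed_subset isClosed_univ ?_⟩
        rintro q -
        obtain ⟨⟨x, z⟩, rfl⟩ := QuotientAddGroup.mk_surjective q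
        refine ⟨(Int.fract x, z - (⌊x⌋ : ℤ)), ⟨⟨Int.fract_nonneg x, (Int.fract_lt_one x).le⟩,
          mem_univ _⟩, ?_⟩
        rw [QuotientAddGroup.eq]
        refine ⟨⌊x⌋, ?_⟩
        ext
        · change ((⌊x⌋ : ℤ) : ℝ) = -Int.fract x + x
          linarith [Int.floor_add_fract x]
        · simp [starMap] }

/-- The powers of `2` are nonzero and tend to `0`. Since `0` is not isolated, Haar measure has no
atoms. -/
theorem nhdsNE_zero_padicInt_neBot : (𝓝[≠] (0 : ℤ_[2])).NeBot := by
  have h : Tendsto (fun n : ℕ => (2 : ℤ_[2]) ^ n) atTop (𝓝[≠] 0) := by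
    refine tendsto_nhdsWithin_iff.2 ⟨tendsto_pow_atTop_nhds_zero_of_norm_lt_one ?_,
      Eventually.of_forall fun n => by simp⟩
    have := PadicInt.norm_p (p := 2)
    norm_num at this
    rw [this]
    norm_num
  exact h.neBot

theorem borelHaar_padicInt_singleton (z : ℤ_[2]) : borelHaar ℤ_[2] {z} = 0 := by
  let : MeasurableSpace ℤ_[2] := borel ℤ_[2]
  have : BorelSpace ℤ_[2] := ⟨rfl⟩
  have := nhdsNE_zero_padicInt_neBot
  exact measure_singleton (μ := (Measure.addHaar : Measure ℤ_[2])) z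

/-- The window is squeezed between an open set and a closed set that differ by at most one point, so
its frontier lies in that point. -/
theorem isRegularModelSet_of_window {O W : Set ℤ_[2]} {z : ℤ_[2]} {Λ : Set ℤ} (hO : IsOpen O)
    (hne : O.Nonempty) (hcl : IsClosed (O ∪ {z})) (hOW : O ⊆ W) (hWO : W ⊆ O ∪ {z})
    (hΛ : ∀ n : ℤ, (n : ℤ_[2]) ∈ W ↔ n ∈ Λ) :
    IsRegularModelSet physicalMap starMap 0 W ((fun n : ℤ => (n : ℝ)) '' Λ) where
  scheme := isCutAndProjectScheme_padicInt
  relativelyCompact := isClosed_closure.isCompact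
  interior_nonempty := hne.mono (interior_maximal hOW hO)
  frontier_null := by
    have : frontier W ⊆ {z} := by
      intro x hx
      have h1 : x ∈ O ∪ {z} := closure_minimal hWO hcl hx.1
      exact h1.resolve_left fun h => hx.2 (interior_maximal hOW hO h)
    exact measure_mono_null this (borelHaar_padicInt_singleton z)
  eq_translate := by
    have : starMap ⁻¹' W = Λ := by
      ext n
      exact hΛ n
    simp [projectedSet, this, physicalMap]

theorem isRegularModelSet_twoAdicClosure {O : Set ℤ_[2]} {z : ℤ_[2]} {Λ : Set ℤ} (hO : IsOpen O)
    (hne : O.Nonempty) (hcl : IsClosed (O ∪ {z})) (hΛO : ∀ n : ℤ, (n : ℤ_[2]) ∈ O → n ∈ Λ)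
    (hΛ : ∀ n : ℤ, n ∈ Λ ↔ (n : ℤ_[2]) ∈ O ∪ {z}) :
    IsRegularModelSet physicalMap starMap 0 (twoAdicClosure Λ) ((fun n : ℤ => (n : ℝ)) '' Λ) := by
  have hsub : twoAdicClosure Λ ⊆ O ∪ {z} := by
    refine closure_minimal ?_ hcl
    rintro _ ⟨n, hn, rfl⟩
    exact (hΛ n).1 hn
  refine isRegularModelSet_of_window hO hne hcl ?_ hsub fun n => ⟨fun h => (hΛ n).2 (hsub h),
    fun h => subset_closure ⟨n, h, rfl⟩⟩
  -- The integers are dense, so the integers of the open set `O` are dense in `O`.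
  refine (PadicInt.denseRange_intCast.open_subset_closure_inter hO).trans (closure_mono ?_)
  rintro _ ⟨hx, n, rfl⟩
  exact ⟨n, hΛO n hx, rfl⟩

theorem isRegularModelSet_twoAdicClosure_diff {O : Set ℤ_[2]} {z : ℤ_[2]} {Λ : Set ℤ}
    (hO : IsOpen O) (hne : O.Nonempty) (hcl : IsClosed (O ∪ {z})) (hz : z ∉ O)
    (hΛ : ∀ n : ℤ, n ∈ Λ ↔ (n : ℤ_[2]) ∈ O) :
    IsRegularModelSet physicalMap starMap 0 (twoAdicClosure Λ \ {z})
      ((fun n : ℤ => (n : ℝ)) '' Λ) := by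
  have hsub : twoAdicClosure Λ ⊆ O ∪ {z} := by
    refine closure_minimal ?_ hcl
    rintro _ ⟨n, hn, rfl⟩
    exact Or.inl ((hΛ n).1 hn)
  have hsup : O ⊆ twoAdicClosure Λ := by
    refine (PadicInt.denseRange_intCast.open_subset_closure_inter hO).trans (closure_mono ?_)
    rintro _ ⟨hx, n, rfl⟩
    exact ⟨n, (hΛ n).2 hx, rfl⟩
  refine isRegularModelSet_of_window hO hne hcl (fun x hx => ⟨hsup hx, ?_⟩)
    (sdiff_subset.trans hsub) fun n => ⟨fun h => ?_, fun h => ⟨subset_closure ⟨n, h, rfl⟩, ?_⟩⟩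
  · rintro rfl
    exact hz hx
  · exact (hΛ n).2 ((hsub h.1).resolve_right h.2)
  · rintro rfl
    exact hz ((hΛ n).1 h)

/-! ### The windows -/

/-- The `2`-adic integers `z` for which the odd part of `z + 1` is congruent to `s` modulo `4`. -/
def padicSignSet (s : ℤ) : Set ℤ_[2] := ⋃ m : ℕ, {z | (2 : ℤ_[2]) ^ (m + 2) ∣ z + 1 - s * 2 ^ m}

theorem two_pow_dvd_intCast_iff (n : ℕ) (a : ℤ) : (2 : ℤ_[2]) ^ n ∣ (a : ℤ_[2]) ↔ 2 ^ n ∣ a := by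
  exact_mod_cast PadicInt.pow_p_dvd_int_iff (p := 2) n a

theorem isClopen_setOf_two_pow_dvd_sub (n : ℕ) (c : ℤ_[2]) :
    IsClopen {z : ℤ_[2] | (2 : ℤ_[2]) ^ n ∣ z - c} := by
  have : {z : ℤ_[2] | (2 : ℤ_[2]) ^ n ∣ z - c} = Metric.closedBall c ((2 : ℝ) ^ (-n : ℤ)) := by
    ext z
    have := PadicInt.norm_le_pow_iff_mem_span_pow (z - c) n
    rw [Ideal.mem_span_singleton] at this
    push_cast at this
    rw [mem_closedBall_iff_norm, this]
    rfl
  rw [this]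
  exact IsUltrametricDist.isClopen_closedBall _ (by positivity)

theorem isOpen_padicSignSet (s : ℤ) : IsOpen (padicSignSet s) := by
  refine isOpen_iUnion fun m => ?_
  convert (isClopen_setOf_two_pow_dvd_sub (m + 2) (s * 2 ^ m - 1)).isOpen using 4
  ring

theorem intCast_mem_padicSignSet {s n : ℤ} : (n : ℤ_[2]) ∈ padicSignSet s ↔ n ∈ signSet s := by
  rw [mem_signSet]
  simp only [padicSignSet, mem_iUnion, mem_ofPred_eq]
  refine exists_congr fun m => ?_
  have := two_pow_dvd_intCast_iff (m + 2) (n + 1 - s * 2 ^ m)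
  push_cast at this
  rw [this]
  refine exists_congr fun k => ?_
  rw [sub_eq_iff_eq_add, show (2 : ℤ) ^ (m + 2) * k + s * 2 ^ m = 2 ^ m * (4 * k + s) by ring]

/-- A nonempty open intersection would contain an integer with both signs. -/
theorem disjoint_padicSignSet : Disjoint (padicSignSet 1) (padicSignSet 3) := by
  rw [disjoint_iff_inter_eq_empty]
  by_contra! hne
  obtain ⟨n, h1, h3⟩ := PadicInt.denseRange_intCast.exists_mem_open
    ((isOpen_padicSignSet 1).inter (isOpen_padicSignSet 3)) hne
  exact Set.disjoint_left.1 disjoint_signSet (intCast_mem_padicSignSet.1 h1)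
    (intCast_mem_padicSignSet.1 h3)

theorem exists_intCast_two_pow_dvd_sub (n : ℕ) (z : ℤ_[2]) :
    ∃ a : ℤ, (2 : ℤ_[2]) ^ n ∣ z - a := by
  obtain ⟨a, ha⟩ := PadicInt.denseRange_intCast.exists_mem_open
    (isClopen_setOf_two_pow_dvd_sub n z).isOpen ⟨z, by simp⟩
  exact ⟨a, (dvd_sub_comm).1 ha⟩

/-- Write `z + 1` as a unit times a power of `2`. The unit is congruent modulo `4` to an odd
integer, whose residue is the sign. -/
theorem mem_padicSignSet_one_or_three {z : ℤ_[2]} (hz : z ≠ -1) :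
    z ∈ padicSignSet 1 ∨ z ∈ padicSignSet 3 := by
  have hz' : z + 1 ≠ 0 := fun h => hz (eq_neg_of_add_eq_zero_left h)
  set m := (z + 1).valuation with hm
  obtain ⟨u, hu⟩ : ∃ u : ℤ_[2]ˣ, z + 1 = u * 2 ^ m :=
    ⟨PadicInt.unitCoeff hz', by exact_mod_cast PadicInt.unitCoeff_spec hz'⟩
  obtain ⟨a, ha⟩ := exists_intCast_two_pow_dvd_sub 2 (u : ℤ_[2])
  have hodd : Odd a := by
    rw [← Int.not_even_iff_odd]
    intro heven
    have h2 : (2 : ℤ_[2]) ∣ a := by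
      have := two_pow_dvd_intCast_iff 1 a
      simp only [pow_one] at this
      exact this.2 heven.two_dvd
    have h2u : (2 : ℤ_[2]) ∣ u := by
      have := dvd_add ((dvd_pow_self 2 two_ne_zero).trans ha) h2
      rwa [sub_add_cancel] at this
    have := PadicInt.prime_p (p := 2)
    exact this.not_isUnit (isUnit_of_dvd_unit (by exact_mod_cast h2u) u.isUnit)
  have key : ∀ s : ℤ, (4 : ℤ) ∣ a - s → z ∈ padicSignSet s := by
    intro s hs
    refine mem_iUnion.2 ⟨m, ?_⟩
    have h1 : (2 : ℤ_[2]) ^ 2 ∣ ((a - s : ℤ) : ℤ_[2]) := (two_pow_dvd_intCast_iff 2 _).2 hs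
    have h2 := mul_dvd_mul_left ((2 : ℤ_[2]) ^ m) (dvd_add ha h1)
    rw [← pow_add] at h2
    rw [mem_ofPred_eq, hu]
    convert h2 using 1
    push_cast
    ring
  obtain ⟨t, ht⟩ := hodd
  obtain h | h : (4 : ℤ) ∣ a - 1 ∨ (4 : ℤ) ∣ a - 3 := by omega
  · exact Or.inl (key 1 h)
  · exact Or.inr (key 3 h)

theorem neg_one_notMem_padicSignSet {s : ℤ} (hs : Odd s) : (-1 : ℤ_[2]) ∉ padicSignSet s := by
  have := (intCast_mem_padicSignSet (s := s) (n := -1)).not.2 (neg_one_notMem_signSet hs)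
  simpa using this

/-- Adjoining `-1` to one sign set gives the complement of the other, which is open. -/
theorem isClosed_padicSignSet_union {s : ℤ} (hs : s = 1 ∨ s = 3) :
    IsClosed (padicSignSet s ∪ {-1}) := by
  have h1 := neg_one_notMem_padicSignSet (s := 1) odd_one
  have h3 := neg_one_notMem_padicSignSet (s := 3) (by decide)
  have hd := Set.disjoint_left.1 disjoint_padicSignSet
  rcases hs with rfl | rfl
  · have : padicSignSet 1 ∪ {-1} = (padicSignSet 3)ᶜ := by
      ext z
      have hz := @mem_padicSignSet_one_or_three z
      by_cases h : z = -1
      · subst h; simp [h3]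
      · have := @hd z
        simp only [mem_union, mem_singleton_iff, mem_compl_iff]
        tauto
    rw [this]
    exact (isOpen_padicSignSet 3).isClosed_compl
  · have : padicSignSet 3 ∪ {-1} = (padicSignSet 1)ᶜ := by
      ext z
      have hz := @mem_padicSignSet_one_or_three z
      by_cases h : z = -1
      · subst h; simp [h1]
      · have := @hd z
        simp only [mem_union, mem_singleton_iff, mem_compl_iff]
        tauto
    rw [this]
    exact (isOpen_padicSignSet 1).isClosed_compl

/-- The even `2`-adic integers. -/
def padicEven : Set ℤ_[2] := {z | (2 : ℤ_[2]) ∣ z}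

theorem isClopen_padicEven : IsClopen padicEven := by
  simpa using! isClopen_setOf_two_pow_dvd_sub 1 0

theorem intCast_mem_padicEven {n : ℤ} : (n : ℤ_[2]) ∈ padicEven ↔ Even n := by
  rw [even_iff_two_dvd]
  simpa using! two_pow_dvd_intCast_iff 1 n

theorem neg_one_notMem_padicEven : (-1 : ℤ_[2]) ∉ padicEven := by
  have := (intCast_mem_padicEven (n := -1)).not.2 (by decide)
  simpa using this

theorem intCast_eq_neg_one_iff {n : ℤ} : (n : ℤ_[2]) = -1 ↔ n = -1 := by
  exact_mod_cast Int.cast_inj (α := ℤ_[2]) (m := n) (n := -1)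

/-! ### Model sets cut out of a sign set by a clopen set -/

section Clopen

variable {E : Set ℤ_[2]} {R Λ : Set ℤ} {s : ℤ}

theorem isClosed_clopen_inter_padicSignSet_union (hE : IsClopen E) (hs : s = 1 ∨ s = 3) :
    IsClosed (E ∩ padicSignSet s ∪ {-1}) := by
  have h := (hE.isClosed.inter (isClosed_padicSignSet_union hs)).union
    (isClosed_singleton (x := (-1 : ℤ_[2])))
  convert h using 1
  ext z
  simp only [mem_union, mem_inter_iff, mem_singleton_iff]
  tauto

theorem isClosed_clopen_inter_padicSignSet (hE : IsClopen E) (hs : s = 1 ∨ s = 3)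
    (hE1 : (-1 : ℤ_[2]) ∉ E) : IsClosed (E ∩ padicSignSet s) := by
  convert hE.isClosed.inter (isClosed_padicSignSet_union hs) using 1
  ext z
  simp only [mem_union, mem_inter_iff, mem_singleton_iff]
  constructor
  · tauto
  · rintro ⟨h, h' | rfl⟩
    · exact ⟨h, h'⟩
    · exact absurd h hE1

/-- A sign set on a clopen set avoiding `-1`. -/
theorem isRegularModelSet_clopen (hE : IsClopen E) (hER : ∀ n : ℤ, (n : ℤ_[2]) ∈ E ↔ n ∈ R)
    (hs : s = 1 ∨ s = 3) (hE1 : (-1 : ℤ_[2]) ∉ E) (hne : (R ∩ signSet s).Nonempty)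
    (hΛ : Λ = R ∩ signSet s) :
    IsRegularModelSet physicalMap starMap 0 (twoAdicClosure Λ) ((fun n : ℤ => (n : ℝ)) '' Λ) := by
  obtain ⟨k, hk, hk'⟩ := hne
  have hkO : (k : ℤ_[2]) ∈ E ∩ padicSignSet s := ⟨(hER k).2 hk, intCast_mem_padicSignSet.2 hk'⟩
  have hmem : ∀ n : ℤ, (n : ℤ_[2]) ∈ E ∩ padicSignSet s ↔ n ∈ Λ := fun n => by
    rw [hΛ, mem_inter_iff, mem_inter_iff, hER, intCast_mem_padicSignSet]
  have hun : E ∩ padicSignSet s ∪ {(k : ℤ_[2])} = E ∩ padicSignSet s :=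
    union_eq_self_of_subset_right (singleton_subset_iff.2 hkO)
  -- Here `E ∩ padicSignSet s` is already closed; the extra point is taken inside it and adds
  -- nothing.
  refine isRegularModelSet_twoAdicClosure (O := E ∩ padicSignSet s) (z := k)
    (hE.isOpen.inter (isOpen_padicSignSet s)) ⟨k, hkO⟩ ?_ (fun n => (hmem n).1) fun n => ?_
  · rw [hun]
    exact isClosed_clopen_inter_padicSignSet hE hs hE1
  · rw [hun, hmem]

/-- A sign set on a clopen set, together with the point `-1`. -/
theorem isRegularModelSet_clopen_union (hE : IsClopen E)
    (hER : ∀ n : ℤ, (n : ℤ_[2]) ∈ E ↔ n ∈ R) (hs : s = 1 ∨ s = 3)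
    (hne : (R ∩ signSet s).Nonempty) (hΛ : Λ = R ∩ signSet s ∪ {-1}) :
    IsRegularModelSet physicalMap starMap 0 (twoAdicClosure Λ) ((fun n : ℤ => (n : ℝ)) '' Λ) := by
  obtain ⟨k, hk, hk'⟩ := hne
  have hmem : ∀ n : ℤ, (n : ℤ_[2]) ∈ E ∩ padicSignSet s ↔ n ∈ R ∩ signSet s := fun n => by
    rw [mem_inter_iff, mem_inter_iff, hER, intCast_mem_padicSignSet]
  refine isRegularModelSet_twoAdicClosure (O := E ∩ padicSignSet s) (z := -1)
    (hE.isOpen.inter (isOpen_padicSignSet s)) ⟨k, (hmem k).2 ⟨hk, hk'⟩⟩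
    (isClosed_clopen_inter_padicSignSet_union hE hs)
    (fun n h => hΛ ▸ Or.inl ((hmem n).1 h)) fun n => ?_
  rw [hΛ, mem_union, mem_union, hmem, mem_singleton_iff, mem_singleton_iff, intCast_eq_neg_one_iff]

/-- A sign set on a clopen set, whose closure may contain the additional point `-1`. -/
theorem isRegularModelSet_clopen_diff (hE : IsClopen E)
    (hER : ∀ n : ℤ, (n : ℤ_[2]) ∈ E ↔ n ∈ R) (hs : s = 1 ∨ s = 3)
    (hne : (R ∩ signSet s).Nonempty) (hΛ : Λ = R ∩ signSet s) :
    IsRegularModelSet physicalMap starMap 0 (twoAdicClosure Λ \ {-1})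
      ((fun n : ℤ => (n : ℝ)) '' Λ) := by
  obtain ⟨k, hk, hk'⟩ := hne
  have hmem : ∀ n : ℤ, n ∈ Λ ↔ (n : ℤ_[2]) ∈ E ∩ padicSignSet s := fun n => by
    rw [hΛ, mem_inter_iff, mem_inter_iff, hER, intCast_mem_padicSignSet]
  refine isRegularModelSet_twoAdicClosure_diff (O := E ∩ padicSignSet s) (z := -1)
    (hE.isOpen.inter (isOpen_padicSignSet s)) ⟨k, (hmem k).1 (hΛ ▸ ⟨hk, hk'⟩)⟩
    (isClosed_clopen_inter_padicSignSet_union hE hs)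
    (fun h => neg_one_notMem_padicSignSet (s := s) ?_ h.2) hmem
  rcases hs with rfl | rfl <;> decide

end Clopen

/-! ### Means of functions on the integers -/

/-- The intAverage of `f` over the integers `x` with `-n < x < n`, normalised by `2 * n`. -/
noncomputable def intAverage (f : ℤ → ℂ) (n : ℕ) : ℂ :=
  (∑ x ∈ Finset.Ioo (-n : ℤ) n, f x) / (2 * n)

/-- `f` has the mean value `μ` along the intervals `(-n, n)`. -/
def HasMean (f : ℤ → ℂ) (μ : ℂ) : Prop := Tendsto (intAverage f) atTop (𝓝 μ)

namespace HasMean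

variable {f g : ℤ → ℂ} {μ ν : ℂ}

theorem add (hf : HasMean f μ) (hg : HasMean g ν) : HasMean (fun x => f x + g x) (μ + ν) := by
  refine (Tendsto.add hf hg).congr fun n => ?_
  simp only [intAverage, Finset.sum_add_distrib, add_div]

theorem const_mul (c : ℂ) (hf : HasMean f μ) : HasMean (fun x => c * f x) (c * μ) := by
  refine (Tendsto.const_mul c hf).congr fun n => ?_
  simp only [intAverage, ← Finset.mul_sum, mul_div_assoc]

theorem sum {ι : Type*} {s : Finset ι} {f : ι → ℤ → ℂ} {μ : ι → ℂ}
    (h : ∀ i ∈ s, HasMean (f i) (μ i)) : HasMean (fun x => ∑ i ∈ s, f i x) (∑ i ∈ s, μ i) := by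
  refine (tendsto_finsetSum s h).congr fun n => ?_
  simp only [intAverage, ← Finset.sum_div]
  rw [Finset.sum_comm]

end HasMean

theorem card_Ioo_neg (n : ℕ) : ((Finset.Ioo (-n : ℤ) n).card : ℤ) = 2 * n - 1 ∨ n = 0 := by
  rw [Int.card_Ioo]
  omega

theorem hasMean_const (c : ℂ) : HasMean (fun _ => c) c := by
  -- The interval has `2 * n - 1` points but the normalisation is its length `2 * n`, whence the
  -- correction `c / (2 * n)`.
  have h : Tendsto (fun n : ℕ => c - c / 2 * ((n : ℂ))⁻¹) atTop (𝓝 (c - c / 2 * 0)) :=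
    tendsto_const_nhds.sub (tendsto_inv_atTop_nhds_zero_nat.const_mul _)
  rw [mul_zero, sub_zero] at h
  refine h.congr' ?_
  filter_upwards [eventually_gt_atTop 0] with n hn
  have hn' : (n : ℂ) ≠ 0 := by exact_mod_cast hn.ne'
  have hc : ((Finset.Ioo (-n : ℤ) n).card : ℂ) = 2 * n - 1 := by
    exact_mod_cast (card_Ioo_neg n).resolve_right hn.ne'
  rw [intAverage, Finset.sum_const, nsmul_eq_mul, hc]
  field_simp

theorem hasMean_zero_of_norm_sum_le {f : ℤ → ℂ} (C : ℝ)
    (h : ∀ n : ℕ, ‖∑ x ∈ Finset.Ioo (-n : ℤ) n, f x‖ ≤ C) : HasMean f 0 := by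
  have h0 : Tendsto (fun n : ℕ => C / 2 * (n : ℝ)⁻¹) atTop (𝓝 (C / 2 * 0)) :=
    tendsto_inv_atTop_nhds_zero_nat.const_mul _
  rw [mul_zero] at h0
  refine squeeze_zero_norm (fun n => ?_) h0
  rw [intAverage, norm_div]
  have : ‖(2 * n : ℂ)‖ = 2 * n := by simp
  rw [this, ← div_eq_mul_inv, div_div]
  exact div_le_div_of_nonneg_right (h n) (by positivity)

theorem sum_Ioo_shift_sub (f : ℤ → ℂ) (n : ℕ) :
    ∑ x ∈ Finset.Ioo (-(n + 1 : ℕ) : ℤ) (n + 1 : ℕ), (f (x + 1) - f x) = f (n + 1) - f (-n) := by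
  induction n with
  | zero => simp [show Finset.Ioo (-1 : ℤ) 1 = {0} by decide]
  | succ n ih =>
    have h : Finset.Ioo (-(n + 1 + 1 : ℕ) : ℤ) (n + 1 + 1 : ℕ) =
        insert (-(n + 1 : ℤ)) (insert (n + 1 : ℤ)
          (Finset.Ioo (-(n + 1 : ℕ) : ℤ) (n + 1 : ℕ))) := by
      ext x
      simp only [Finset.mem_Ioo, Finset.mem_insert]
      push_cast
      omega
    rw [h, Finset.sum_insert, Finset.sum_insert, ih]
    · push_cast
      rw [show -((n : ℤ) + 1) + 1 = -n by ring]
      ring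
    · simp
    · simp only [Finset.mem_Ioo, Finset.mem_insert]
      push_cast
      omega

/-- For shift `1` the sums telescope to two boundary terms, hence stay bounded; larger shifts follow
by induction. -/
theorem hasMean_shift_sub {f : ℤ → ℂ} {C : ℝ} (hf : ∀ x, ‖f x‖ ≤ C) (q : ℕ) :
    HasMean (fun x => f (x + q) - f x) 0 := by
  induction q with
  | zero => simpa using hasMean_const 0
  | succ q ih =>
    have h : HasMean (fun x => f (x + 1 + q) - f (x + q)) 0 := by
      refine hasMean_zero_of_norm_sum_le (C + C) fun n => ?_
      rcases n with _ | n
      · simpa using (norm_nonneg _).trans (hf 0)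
      · rw [sum_Ioo_shift_sub (fun x => f (x + q))]
        exact (norm_sub_le _ _).trans (add_le_add (hf _) (hf _))
    have h2 := h.add ih
    rw [add_zero] at h2
    convert h2 using 2 with x
    push_cast
    rw [show x + (q + 1 : ℤ) = x + 1 + q by ring]
    ring

/-- Antiperiodicity makes `f` equal to `-1 / 2` times a shift difference of itself. -/
theorem hasMean_zero_of_antiperiodic {f : ℤ → ℂ} {C : ℝ} (hf : ∀ x, ‖f x‖ ≤ C) {q : ℕ}
    (hq : ∀ x, f (x + q) = -f x) : HasMean f 0 := by
  have h := (hasMean_shift_sub hf q).const_mul (-1 / 2)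
  rw [mul_zero] at h
  convert h using 2 with x
  rw [hq]
  ring

/-- A function that is approximated in the mean by functions with a mean has a mean. -/
theorem hasMean_of_approx {f : ℤ → ℂ} {F : ℕ → ℤ → ℂ} {e : ℕ → ℤ → ℝ} {ν : ℕ → ℂ} {ε : ℕ → ℝ}
    {μ : ℂ} (hF : ∀ p, HasMean (F p) (ν p)) (he : ∀ p, HasMean (fun x => (e p x : ℂ)) (ε p))
    (hfe : ∀ p x, ‖f x - F p x‖ ≤ e p x) (hν : Tendsto ν atTop (𝓝 μ))
    (hε : Tendsto ε atTop (𝓝 0)) : HasMean f μ := by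
  refine Metric.tendsto_atTop'.2 fun δ hδ => ?_
  obtain ⟨p, hp1, hp2⟩ := (((Metric.tendsto_nhds.1 hν) (δ / 4) (by positivity)).and
    ((Metric.tendsto_nhds.1 hε) (δ / 4) (by positivity))).exists
  have h := ((Metric.tendsto_nhds.1 (hF p)) (δ / 4) (by positivity)).and
    ((Metric.tendsto_nhds.1 (he p)) (δ / 4) (by positivity))
  obtain ⟨N, hN⟩ := eventually_atTop.1 h
  refine ⟨N, fun n hn => ?_⟩
  obtain ⟨h1, h2⟩ := hN n hn.le
  have h3 : ‖intAverage f n - intAverage (F p) n‖ ≤ ‖intAverage (fun x => (e p x : ℂ)) n‖ := by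
    have hE : intAverage (fun x => (e p x : ℂ)) n =
        (((∑ x ∈ Finset.Ioo (-n : ℤ) n, e p x) / (2 * n) : ℝ) : ℂ) := by
      simp [intAverage]
    have h2n : ‖(2 * n : ℂ)‖ = 2 * n := by simp
    rw [hE, Complex.norm_real, intAverage, intAverage, ← sub_div, ← Finset.sum_sub_distrib, norm_div,
      h2n]
    refine le_trans ?_ (le_abs_self _)
    exact div_le_div_of_nonneg_right ((norm_sum_le _ _).trans
      (Finset.sum_le_sum fun x _ => hfe p x)) (by positivity)
  rw [dist_eq_norm] at h1 h2 hp1 hp2 ⊢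
  rw [sub_zero, Real.norm_eq_abs] at hp2
  have h4 : ‖intAverage (fun x => (e p x : ℂ)) n‖ ≤ δ / 4 + |ε p| := by
    have := norm_le_norm_add_norm_sub' (intAverage (fun x => (e p x : ℂ)) n) (ε p : ℂ)
    rw [Complex.norm_real, Real.norm_eq_abs] at this
    linarith
  calc ‖intAverage f n - μ‖ = ‖(intAverage f n - intAverage (F p) n) + (intAverage (F p) n - ν p) +
        (ν p - μ)‖ := by congr 1; ring
    _ ≤ ‖intAverage f n - intAverage (F p) n‖ + ‖intAverage (F p) n - ν p‖ + ‖ν p - μ‖ := norm_add₃_le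
    _ < δ := by linarith

/-! ### Dyadic square waves -/

/-- The indicator function of the multiples of `2 ^ r`. -/
noncomputable def dyadicInd (r : ℕ) (y : ℤ) : ℂ := if (2 : ℤ) ^ r ∣ y then 1 else 0

/-- The function on the multiples of `2 ^ r` that alternates between `1` and `-1`. -/
noncomputable def dyadicWave (r : ℕ) (y : ℤ) : ℂ := 2 * dyadicInd (r + 1) y - dyadicInd r y

theorem dyadicInd_zero (y : ℤ) : dyadicInd 0 y = 1 := by simp [dyadicInd]

theorem two_pow_succ_dvd_imp {r : ℕ} {y : ℤ} (h : (2 : ℤ) ^ (r + 1) ∣ y) : (2 : ℤ) ^ r ∣ y :=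
  (pow_dvd_pow 2 r.le_succ).trans h

theorem two_pow_succ_dvd_mul_iff {r : ℕ} {k : ℤ} : (2 : ℤ) ^ (r + 1) ∣ 2 ^ r * k ↔ 2 ∣ k := by
  rw [pow_succ]
  exact mul_dvd_mul_iff_left (by positivity)

theorem dyadicWave_two_pow_mul (r : ℕ) (k : ℤ) :
    dyadicWave r (2 ^ r * k) = if Even k then 1 else -1 := by
  simp only [dyadicWave, dyadicInd, two_pow_succ_dvd_mul_iff, dvd_mul_right, if_true,
    even_iff_two_dvd]
  split_ifs <;> norm_num

theorem dyadicWave_of_not_dvd {r : ℕ} {y : ℤ} (h : ¬ (2 : ℤ) ^ r ∣ y) : dyadicWave r y = 0 := by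
  have : ¬ (2 : ℤ) ^ (r + 1) ∣ y := fun h' => h (two_pow_succ_dvd_imp h')
  simp [dyadicWave, dyadicInd, h, this]

theorem norm_dyadicWave_le (r : ℕ) (y : ℤ) : ‖dyadicWave r y‖ ≤ 1 := by
  by_cases h : (2 : ℤ) ^ r ∣ y
  · obtain ⟨k, rfl⟩ := h
    rw [dyadicWave_two_pow_mul]
    split_ifs <;> simp
  · simp [dyadicWave_of_not_dvd h]

/-- On the multiples of `2 ^ r` the wave is a character with values `1` and `-1`. If `y` is such a
multiple and `m` is not, then neither is `y - m`, and both sides vanish. -/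
theorem dyadicWave_mul_sub (r : ℕ) (y m : ℤ) :
    dyadicWave r y * dyadicWave r (y - m) = dyadicWave r m * dyadicInd r y := by
  by_cases h : (2 : ℤ) ^ r ∣ y
  · obtain ⟨k, rfl⟩ := h
    by_cases hm : (2 : ℤ) ^ r ∣ m
    · obtain ⟨l, rfl⟩ := hm
      rw [← mul_sub]
      simp only [dyadicWave_two_pow_mul, dyadicInd, dvd_mul_right, if_true, Int.even_sub]
      by_cases hk : Even k <;> by_cases hl : Even l <;> simp only [hk, hl] <;> norm_num
    · have : ¬ (2 : ℤ) ^ r ∣ 2 ^ r * k - m := by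
        rwa [dvd_sub_right (dvd_mul_right _ _)]
      simp [dyadicWave_of_not_dvd hm, dyadicWave_of_not_dvd this]
  · simp [dyadicWave_of_not_dvd h, dyadicInd, h]

theorem dyadicInd_add_of_dvd {r : ℕ} {q : ℤ} (h : (2 : ℤ) ^ r ∣ q) (y : ℤ) :
    dyadicInd r (y + q) = dyadicInd r y := by
  simp only [dyadicInd, dvd_add_left h]

theorem dyadicWave_add_of_dvd {r : ℕ} {q : ℤ} (h : (2 : ℤ) ^ (r + 1) ∣ q) (y : ℤ) :
    dyadicWave r (y + q) = dyadicWave r y := by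
  simp only [dyadicWave, dyadicInd_add_of_dvd h, dyadicInd_add_of_dvd (two_pow_succ_dvd_imp h)]

theorem dyadicWave_add_two_pow (r : ℕ) (y : ℤ) : dyadicWave r (y + 2 ^ r) = -dyadicWave r y := by
  by_cases h : (2 : ℤ) ^ r ∣ y
  · obtain ⟨k, rfl⟩ := h
    rw [← mul_add_one, dyadicWave_two_pow_mul, dyadicWave_two_pow_mul]
    by_cases hk : Even k <;> simp only [Int.even_add_one, hk] <;> simp
  · rw [dyadicWave_of_not_dvd h, dyadicWave_of_not_dvd, neg_zero]
    rwa [dvd_add_left dvd_rfl]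

theorem hasMean_dyadicWave (r : ℕ) (c : ℤ) : HasMean (fun x => dyadicWave r (x + c)) 0 := by
  refine hasMean_zero_of_antiperiodic (C := 1) (fun x => norm_dyadicWave_le _ _) (q := 2 ^ r)
    fun x => ?_
  push_cast
  rw [add_right_comm, dyadicWave_add_two_pow]

theorem hasMean_dyadicInd (r : ℕ) (c : ℤ) :
    HasMean (fun x => dyadicInd r (x + c)) (((2 : ℂ) ^ r)⁻¹) := by
  induction r with
  | zero => simpa [dyadicInd_zero] using hasMean_const 1
  | succ r ih =>
    -- The indicator of order `r + 1` is half the sum of the indicator and the wave of order `r`.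
    have h := (ih.add (hasMean_dyadicWave r c)).const_mul (1 / 2)
    convert h using 1
    · funext x
      simp only [dyadicWave]
      ring
    · rw [pow_succ]
      field_simp
      simp

theorem hasMean_dyadicWave_mul_self (r : ℕ) (c m : ℤ) :
    HasMean (fun x => dyadicWave r (x + c) * dyadicWave r (x - m + c))
      (((2 : ℂ) ^ r)⁻¹ * dyadicWave r m) := by
  have h := (hasMean_dyadicInd r c).const_mul (dyadicWave r m)
  rw [mul_comm]
  convert h using 2 with x
  rw [← dyadicWave_mul_sub]
  congr 2
  ring

/-- A shift by `2 ^ t` reverses the wave of order `t` and is a period of the wave of order `r < t`,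
so the product is antiperiodic. -/
theorem hasMean_dyadicWave_mul_of_lt {r t : ℕ} (h : r < t) (c d : ℤ) :
    HasMean (fun x => dyadicWave r (x + c) * dyadicWave t (x + d)) 0 := by
  refine hasMean_zero_of_antiperiodic (C := 1) (fun x => ?_) (q := 2 ^ t) fun x => ?_
  · rw [norm_mul]
    exact mul_le_one₀ (norm_dyadicWave_le _ _) (norm_nonneg _) (norm_dyadicWave_le _ _)
  · push_cast
    rw [add_right_comm, add_right_comm x _ d, dyadicWave_add_two_pow,
      dyadicWave_add_of_dvd (pow_dvd_pow 2 h)]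
    ring

theorem hasMean_dyadicWave_mul_of_ne {r t : ℕ} (h : r ≠ t) (c d : ℤ) :
    HasMean (fun x => dyadicWave r (x + c) * dyadicWave t (x + d)) 0 := by
  rcases lt_or_gt_of_ne h with h | h
  · exact hasMean_dyadicWave_mul_of_lt h c d
  · simpa only [mul_comm] using hasMean_dyadicWave_mul_of_lt h d c

theorem conj_dyadicWave (r : ℕ) (y : ℤ) : conj (dyadicWave r y) = dyadicWave r y := by
  simp only [dyadicWave, dyadicInd, map_sub, map_mul, map_ofNat, apply_ite (conj : ℂ → ℂ), map_one,
    map_zero]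

/-! ### The autocorrelation coefficients of a dyadic series -/

/-- The partial sums of a series of shifted dyadic square waves. -/
noncomputable def wavePartialSum (d : ℂ) (c : ℕ → ℂ) (o : ℕ → ℤ) (p : ℕ) (x : ℤ) : ℂ :=
  d + ∑ r ∈ Finset.range p, c r * dyadicWave r (x + o r)

/-- The autocorrelation coefficients of the partial sums of a series of dyadic square waves. -/
noncomputable def partialCorrelation (d : ℂ) (c : ℕ → ℂ) (p : ℕ) (m : ℤ) : ℂ :=
  (‖d‖ ^ 2 : ℝ) + ∑ r ∈ Finset.range p, (‖c r‖ ^ 2 : ℝ) * (((2 : ℂ) ^ r)⁻¹ * dyadicWave r m)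

theorem hasMean_wavePartialSum (d : ℂ) (c : ℕ → ℂ) (o : ℕ → ℤ) (p : ℕ) (m : ℤ) :
    HasMean (fun x => wavePartialSum d c o p x * conj (wavePartialSum d c o p (x - m)))
      (partialCorrelation d c p m) := by
  have h1 : HasMean (fun _ => d * conj d) (‖d‖ ^ 2 : ℝ) := by
    convert hasMean_const (d * conj d) using 1
    rw [Complex.mul_conj, Complex.normSq_eq_norm_sq]
  have h2 : HasMean (fun x => ∑ r ∈ Finset.range p, d * conj (c r) *
      dyadicWave r (x + (-m + o r))) 0 := by
    have := HasMean.sum (s := Finset.range p) fun r _ =>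
      (hasMean_dyadicWave r (-m + o r)).const_mul (d * conj (c r))
    simpa using this
  have h3 : HasMean (fun x => ∑ r ∈ Finset.range p, conj d * c r *
      dyadicWave r (x + o r)) 0 := by
    have := HasMean.sum (s := Finset.range p) fun r _ =>
      (hasMean_dyadicWave r (o r)).const_mul (conj d * c r)
    simpa using this
  have h4 : HasMean (fun x => ∑ r ∈ Finset.range p, ∑ t ∈ Finset.range p, c r * conj (c t) *
      (dyadicWave r (x + o r) * dyadicWave t (x + (-m + o t))))
      (∑ r ∈ Finset.range p, (‖c r‖ ^ 2 : ℝ) * (((2 : ℂ) ^ r)⁻¹ * dyadicWave r m)) := by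
    refine HasMean.sum fun r hr => ?_
    have h : HasMean (fun x => ∑ t ∈ Finset.range p, c r * conj (c t) *
        (dyadicWave r (x + o r) * dyadicWave t (x + (-m + o t))))
        (∑ t ∈ Finset.range p, c r * conj (c t) *
          (if r = t then ((2 : ℂ) ^ r)⁻¹ * dyadicWave r m else 0)) := by
      refine HasMean.sum fun t _ => HasMean.const_mul _ ?_
      split_ifs with hrt
      · subst hrt
        convert hasMean_dyadicWave_mul_self r (o r) m using 4 with x
        ring
      · exact hasMean_dyadicWave_mul_of_ne hrt _ _
    convert h using 1
    simp only [mul_ite, mul_zero, Finset.sum_ite_eq, hr, if_true]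
    rw [Complex.mul_conj, Complex.normSq_eq_norm_sq]
  have h := ((h1.add h2).add h3).add h4
  rw [add_zero, add_zero] at h
  rw [partialCorrelation]
  convert h using 2 with x
  simp only [wavePartialSum, map_add, map_sum, map_mul, conj_dyadicWave, sub_eq_add_neg]
  rw [add_mul, mul_add, mul_add, ← add_assoc, Finset.mul_sum, Finset.sum_mul, Finset.sum_mul_sum]
  congr 1
  · congr 1
    · congr 1
      exact Finset.sum_congr rfl fun r _ => by rw [add_assoc, mul_assoc]
    · exact Finset.sum_congr rfl fun r _ => by ring
  · exact Finset.sum_congr rfl fun r _ => Finset.sum_congr rfl fun t _ => by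
      rw [add_assoc]
      ring

/-- The autocorrelation coefficients of a series of dyadic square waves. -/
noncomputable def waveCorrelation (d : ℂ) (c : ℕ → ℂ) (m : ℤ) : ℂ :=
  (‖d‖ ^ 2 : ℝ) + ∑' r : ℕ, (‖c r‖ ^ 2 : ℝ) * (((2 : ℂ) ^ r)⁻¹ * dyadicWave r m)

theorem summable_waveCorrelation {c : ℕ → ℂ} {K : ℝ} (hc : ∀ r, ‖c r‖ ≤ K) (m : ℤ) :
    Summable fun r : ℕ => ((‖c r‖ ^ 2 : ℝ) : ℂ) * (((2 : ℂ) ^ r)⁻¹ * dyadicWave r m) := by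
  refine Summable.of_norm_bounded (g := fun r : ℕ => K ^ 2 * ((1 / 2 : ℝ) ^ r))
    ((summable_geometric_of_lt_one (by norm_num) (by norm_num)).mul_left _) fun r => ?_
  rw [norm_mul, norm_mul, Complex.norm_real, norm_pow, norm_norm, norm_inv, norm_pow,
    Complex.norm_ofNat, one_div, inv_pow]
  have h1 : ‖c r‖ ^ 2 ≤ K ^ 2 := pow_le_pow_left₀ (norm_nonneg _) (hc r) 2
  have h2 : ((2 : ℝ) ^ r)⁻¹ * ‖dyadicWave r m‖ ≤ ((2 : ℝ) ^ r)⁻¹ :=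
    mul_le_of_le_one_right (by positivity) (norm_dyadicWave_le r m)
  exact mul_le_mul h1 h2 (by positivity) (by positivity)

/-- A bounded function that coincides with a partial sum of a series of dyadic square waves
off each residue class `2 ^ p ℤ - a` has the autocorrelation coefficients of the series. -/
theorem hasMean_of_eq_wavePartialSum {h : ℤ → ℂ} {d : ℂ} {c : ℕ → ℂ} {o : ℕ → ℤ} {a : ℤ} {K : ℝ}
    (hc : ∀ r, ‖c r‖ ≤ K) (hh : ∀ x, ‖h x‖ ≤ K) (hp : ∀ p x, ‖wavePartialSum d c o (p + 1) x‖ ≤ K)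
    (heq : ∀ p x, ¬ (2 : ℤ) ^ p ∣ x + a → h x = wavePartialSum d c o (p + 1) x) (m : ℤ) :
    HasMean (fun x => h x * conj (h (x - m))) (waveCorrelation d c m) := by
  have hK : 0 ≤ K := (norm_nonneg _).trans (hh 0)
  refine hasMean_of_approx
    (F := fun p x => wavePartialSum d c o (p + 1) x * conj (wavePartialSum d c o (p + 1) (x - m)))
    (ν := fun p => partialCorrelation d c (p + 1) m)
    -- The products can differ only if `x` or `x - m` lies in the exceptional residue class, which
    -- has density `2 ^ (-p)`; there the difference is at most `2 * K ^ 2`.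
    (e := fun p x => 2 * K ^ 2 * ((if (2 : ℤ) ^ p ∣ x + a then 1 else 0) +
      (if (2 : ℤ) ^ p ∣ x + (-m + a) then 1 else 0)))
    (ε := fun p => 2 * K ^ 2 * ((2 ^ p)⁻¹ + (2 ^ p)⁻¹))
    (fun p => hasMean_wavePartialSum d c o (p + 1) m) (fun p => ?_) (fun p x => ?_) ?_ ?_
  · have := ((hasMean_dyadicInd p a).add (hasMean_dyadicInd p (-m + a))).const_mul (2 * K ^ 2)
    convert this using 1
    · funext x
      simp only [dyadicInd]
      push_cast [apply_ite Complex.ofReal]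
      rfl
    · push_cast
      rfl
  · have hbd : ‖h x * conj (h (x - m)) -
        wavePartialSum d c o (p + 1) x * conj (wavePartialSum d c o (p + 1) (x - m))‖ ≤
        2 * K ^ 2 := by
      refine (norm_sub_le _ _).trans ?_
      rw [norm_mul, norm_mul, RCLike.norm_conj, RCLike.norm_conj]
      have h1 := mul_le_mul (hh x) (hh (x - m)) (norm_nonneg _) hK
      have h2 := mul_le_mul (hp p x) (hp p (x - m)) (norm_nonneg _) hK
      linarith
    by_cases h1 : (2 : ℤ) ^ p ∣ x + a
    · refine hbd.trans (le_mul_of_one_le_right (by positivity) ?_)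
      rw [if_pos h1]
      split_ifs <;> norm_num
    by_cases h2 : (2 : ℤ) ^ p ∣ x + (-m + a)
    · refine hbd.trans (le_mul_of_one_le_right (by positivity) ?_)
      rw [if_pos h2]
      split_ifs <;> norm_num
    · rw [heq p x h1, heq p (x - m) (by rwa [sub_eq_add_neg, add_assoc])]
      simp [h1, h2]
  · exact ((summable_waveCorrelation hc m).hasSum.tendsto_sum_nat.comp
      (tendsto_add_atTop_nat 1)).const_add _
  · have : Tendsto (fun p : ℕ => ((2 : ℝ) ^ p)⁻¹) atTop (𝓝 0) := by
      exact tendsto_inv_atTop_zero.comp (tendsto_pow_atTop_atTop_of_one_lt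
        (one_lt_two (α := ℝ)))
    simpa using (this.add this).const_mul (2 * K ^ 2)

/-! ### The autocorrelation of a Dirac comb on the integers -/

theorem exists_nat_forall_ne_zero_abs_le (f : C_c(ℝ, ℂ)) : ∃ R : ℕ, ∀ x, f x ≠ 0 → |x| ≤ R := by
  obtain ⟨r, hr⟩ := f.hasCompactSupport.isCompact.isBounded.subset_closedBall 0
  obtain ⟨R, hR⟩ := exists_nat_ge r
  refine ⟨R, fun x hx => ?_⟩
  have := hr (subset_tsupport _ hx)
  rw [mem_closedBall_zero_iff, Real.norm_eq_abs] at this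
  exact this.trans hR

theorem finsum_intCast_eq_sum {η : ℤ → ℂ} {f : ℝ → ℂ} {R : ℕ} (hR : ∀ x, f x ≠ 0 → |x| ≤ R) :
    ∑ᶠ m : ℤ, η m * f m = ∑ m ∈ Finset.Icc (-R : ℤ) R, η m * f m := by
  refine finsum_eq_sum_of_support_subset _ fun m hm => ?_
  have h1 := hR m (right_ne_zero_of_mul hm)
  rw [Finset.coe_Icc, mem_Icc, ← abs_le]
  exact_mod_cast h1

theorem finite_support_mul_intCast (η : ℤ → ℂ) (f : C_c(ℝ, ℂ)) :
    (Function.support fun m : ℤ => η m * f m).Finite := by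
  obtain ⟨R, hR⟩ := exists_nat_forall_ne_zero_abs_le f
  refine (Set.finite_Icc (-R : ℤ) R).subset fun m hm => ?_
  have h1 := hR m (right_ne_zero_of_mul hm)
  rw [mem_Icc, ← abs_le]
  exact_mod_cast h1

/-- The functional `∑ m, η m • δ_m` on compactly supported continuous functions. -/
noncomputable def intComb (η : ℤ → ℂ) : C_c(ℝ, ℂ) →ₗ[ℂ] ℂ where
  toFun f := ∑ᶠ m : ℤ, η m * f m
  map_add' f g := by
    rw [← finsum_add_distrib (finite_support_mul_intCast η f) (finite_support_mul_intCast η g)]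
    simp only [CompactlySupportedContinuousMap.coe_add, Pi.add_apply, mul_add]
  map_smul' c f := by
    rw [RingHom.id_apply, smul_eq_mul, mul_finsum]
    simp only [CompactlySupportedContinuousMap.coe_smul, Pi.smul_apply, smul_eq_mul, mul_left_comm]

theorem isComplexRadon_intComb (η : ℤ → ℂ) : IsComplexRadon (intComb η) := by
  intro K hK
  obtain ⟨r, hr⟩ := hK.isBounded.subset_closedBall 0
  obtain ⟨R, hR⟩ := exists_nat_ge r
  refine ⟨∑ m ∈ Finset.Icc (-R : ℤ) R, ‖η m‖, fun f hf M hM => ?_⟩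
  have h : ∀ x, f x ≠ 0 → |x| ≤ R := fun x hx => by
    have := hr (hf (subset_tsupport _ hx))
    rw [mem_closedBall_zero_iff, Real.norm_eq_abs] at this
    exact this.trans hR
  change ‖∑ᶠ m : ℤ, η m * f m‖ ≤ _
  rw [finsum_intCast_eq_sum h, Finset.sum_mul]
  refine (norm_sum_le _ _).trans (Finset.sum_le_sum fun m _ => ?_)
  rw [norm_mul]
  exact mul_le_mul_of_nonneg_left (hM _) (norm_nonneg _)

/-! ### From mean values of products to the vague limit -/

section Comb

variable {v : ℝ → ℂ} {h : ℤ → ℂ}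

theorem restrictedComb_eq_sum (hv : ∀ n : ℤ, v n = h n)
    (hv0 : ∀ y, y ∉ range (fun n : ℤ => (n : ℝ)) → v y = 0) (n : ℕ) (f : ℝ → ℂ) :
    restrictedComb v n f = ∑ x ∈ Finset.Ioo (-n : ℤ) n, h x * f x := by
  rw [restrictedComb, finsum_eq_sum_of_support_subset (s :=
    (Finset.Ioo (-n : ℤ) n).image fun n : ℤ => (n : ℝ)) _ ?_,
    Finset.sum_image Int.cast_injective.injOn]
  · refine Finset.sum_congr rfl fun x hx => ?_
    rw [Finset.mem_Ioo, ← abs_lt] at hx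
    rw [indicator_of_mem, hv]
    rw [mem_ball_zero_iff, Real.norm_eq_abs]
    exact_mod_cast hx
  · intro y hy
    have h1 := left_ne_zero_of_mul hy
    have h2 := mem_of_indicator_ne_zero h1
    have h3 : y ∈ range (fun n : ℤ => (n : ℝ)) := by
      by_contra hc
      exact h1 (by rw [indicator_of_mem h2, hv0 y hc])
    obtain ⟨m, rfl⟩ := h3
    refine Finset.mem_coe.2 (Finset.mem_image.2 ⟨m, ?_, rfl⟩)
    have h4 : |(m : ℝ)| < n := by simpa using h2
    rw [Finset.mem_Ioo, ← abs_lt]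
    exact_mod_cast h4

/-- The double sum over `x` and `y` is regrouped by the difference `m = x - y`; the bounded support
of `f` leaves finitely many `m`. -/
theorem finiteAutocorrelation_eq_sum (hv : ∀ n : ℤ, v n = h n)
    (hv0 : ∀ y, y ∉ range (fun n : ℤ => (n : ℝ)) → v y = 0) (n : ℕ) {f : ℝ → ℂ} {R : ℕ}
    (hR : ∀ x, f x ≠ 0 → |x| ≤ R) :
    finiteAutocorrelation v n f = ∑ m ∈ Finset.Icc (-R : ℤ) R,
      intAverage (fun x => if x - m ∈ Finset.Ioo (-n : ℤ) n then h x * conj (h (x - m)) else 0) n *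
        f m := by
  have hvol : (((volume (Metric.ball (0 : ℝ) n)).toReal : ℝ) : ℂ) = 2 * n := by
    rw [Real.volume_ball, ENNReal.toReal_ofReal (by positivity)]
    push_cast
    rfl
  have hinner : ∀ x : ℤ, conj (∑ y ∈ Finset.Ioo (-n : ℤ) n, h y * conj (f (x + -y))) =
      ∑ m ∈ Finset.Icc (-R : ℤ) R,
        if x - m ∈ Finset.Ioo (-n : ℤ) n then conj (h (x - m)) * f m else 0 := by
    intro x
    rw [← Finset.sum_filter, map_sum]
    simp only [map_mul, Complex.conj_conj]
    have hz : ∀ y ∈ Finset.Ioo (-n : ℤ) n, y ∉ (Finset.Ioo (-n : ℤ) n).filter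
        (fun y => x - y ∈ Finset.Icc (-R : ℤ) R) → conj (h y) * f (x + -y) = 0 := by
      intro y hy hy'
      rw [mul_eq_zero]
      right
      by_contra hne
      apply hy'
      have := hR _ hne
      rw [Finset.mem_filter, Finset.mem_Icc, ← abs_le]
      refine ⟨hy, ?_⟩
      rw [← sub_eq_add_neg] at this
      exact_mod_cast this
    rw [← Finset.sum_subset (Finset.filter_subset _ _) hz]
    refine Finset.sum_nbij' (fun y => x - y) (fun m => x - m) ?_ ?_ ?_ ?_ ?_
    · intro y hy
      rw [Finset.mem_filter] at hy ⊢
      rw [sub_sub_cancel]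
      exact hy.symm
    · intro y hy
      rw [Finset.mem_filter] at hy ⊢
      rw [sub_sub_cancel]
      exact hy.symm
    · intro y _
      exact sub_sub_cancel _ _
    · intro y _
      exact sub_sub_cancel _ _
    · intro y _
      rw [sub_sub_cancel]
      push_cast
      rw [sub_eq_add_neg]
  rw [finiteAutocorrelation, hvol, convFunctional, restrictedComb_eq_sum hv hv0]
  simp only [tildeFunctional, restrictedComb_eq_sum hv hv0, hinner, intAverage, Finset.mul_sum,
    Finset.sum_div, Finset.sum_mul]
  rw [Finset.sum_comm]
  refine Finset.sum_congr rfl fun m _ => Finset.sum_congr rfl fun x _ => ?_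
  split_ifs
  · ring
  · simp

/-- Shifting the interval by `m` loses at most `|m|` points at each end. This removes the
restriction on `x - m` in the limit. -/
theorem hasMean_boundary {F : ℤ → ℂ} {K : ℝ} (hK : ∀ x, ‖F x‖ ≤ K) (m : ℤ) :
    Tendsto (fun n : ℕ => intAverage (fun x => if x - m ∈ Finset.Ioo (-n : ℤ) n then 0 else F x) n)
      atTop (𝓝 0) := by
  have hK0 : 0 ≤ K := (norm_nonneg _).trans (hK 0)
  have h0 : Tendsto (fun n : ℕ => (2 * |m| : ℤ) * K / 2 * (n : ℝ)⁻¹) atTop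
      (𝓝 ((2 * |m| : ℤ) * K / 2 * 0)) := tendsto_inv_atTop_nhds_zero_nat.const_mul _
  rw [mul_zero] at h0
  refine squeeze_zero_norm (fun n => ?_) h0
  have h2n : ‖(2 * n : ℂ)‖ = 2 * n := by simp
  rw [intAverage, norm_div, h2n, ← div_eq_mul_inv, div_div]
  refine div_le_div_of_nonneg_right ?_ (by positivity)
  have hsub : (Finset.Ioo (-n : ℤ) n).filter (fun x => ¬ x - m ∈ Finset.Ioo (-n : ℤ) n) ⊆
      Finset.Ioc (-n : ℤ) (|m| - n) ∪ Finset.Ico (n - |m|) n := by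
    intro x
    simp only [Finset.mem_filter, Finset.mem_Ioo, Finset.mem_union, Finset.mem_Ioc, Finset.mem_Ico]
    have := le_abs_self m
    have := neg_abs_le m
    omega
  have hcard : ((Finset.Ioo (-n : ℤ) n).filter (fun x => ¬ x - m ∈ Finset.Ioo (-n : ℤ) n)).card ≤
      2 * |m| := by
    have h1 := (Finset.card_le_card hsub).trans (Finset.card_union_le _ _)
    rw [Int.card_Ioc, Int.card_Ico] at h1
    have := abs_nonneg m
    omega
  simp only [← ite_not (p := _ ∈ _)]
  rw [← Finset.sum_filter]
  refine (norm_sum_le_of_le _ fun x _ => hK x).trans ?_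
  rw [Finset.sum_const, nsmul_eq_mul]
  refine mul_le_mul_of_nonneg_right ?_ hK0
  exact_mod_cast hcard

/-- If the correlations of the weights have mean values, then these are the coefficients of the
autocorrelation of the Dirac comb. -/
theorem isAutocorrelation_intComb {η : ℤ → ℂ} {K : ℝ} (hv : ∀ n : ℤ, v n = h n)
    (hv0 : ∀ y, y ∉ range (fun n : ℤ => (n : ℝ)) → v y = 0) (hK : ∀ x, ‖h x‖ ≤ K)
    (hη : ∀ m : ℤ, HasMean (fun x => h x * conj (h (x - m))) (η m)) :
    IsAutocorrelation v (intComb η) := by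
  refine ⟨isComplexRadon_intComb η, fun f => ?_⟩
  obtain ⟨R, hR⟩ := exists_nat_forall_ne_zero_abs_le f
  have hγ : intComb η f = ∑ m ∈ Finset.Icc (-R : ℤ) R, η m * f m := finsum_intCast_eq_sum hR
  rw [hγ]
  simp only [finiteAutocorrelation_eq_sum hv hv0 _ hR]
  refine tendsto_finsetSum _ fun m _ => Tendsto.mul_const _ ?_
  have hb : ∀ x, ‖h x * conj (h (x - m))‖ ≤ K * K := fun x => by
    rw [norm_mul, RCLike.norm_conj]
    exact mul_le_mul (hK _) (hK _) (norm_nonneg _) ((norm_nonneg _).trans (hK 0))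
  have := Tendsto.sub (hη m) (hasMean_boundary hb m)
  rw [sub_zero] at this
  refine this.congr fun n => ?_
  rw [intAverage, intAverage, intAverage, ← sub_div, ← Finset.sum_sub_distrib]
  congr 1
  refine Finset.sum_congr rfl fun x _ => ?_
  split_ifs <;> simp

end Comb

/-! ### The weights of the sign words -/

theorem combWeight_intCast {α : Type*} [Fintype α] (h : α → ℂ) (w : ℤ → α) (n : ℤ) :
    combWeight h w n = h (w n) := by
  classical
  have hmem : ∀ x, (n : ℝ) ∈ pointSet w x ↔ w n = x := fun x => by
    rw [pointSet, Int.cast_injective.mem_set_image]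
    rfl
  simp only [combWeight, indicator_apply, hmem, Finset.sum_ite_eq, Finset.mem_univ, if_true]

theorem combWeight_of_notMem_range {α : Type*} [Fintype α] (h : α → ℂ) (w : ℤ → α) {y : ℝ}
    (hy : y ∉ range (fun n : ℤ => (n : ℝ))) : combWeight h w y = 0 := by
  refine Finset.sum_eq_zero fun x _ => indicator_of_notMem ?_ _
  rintro ⟨n, -, rfl⟩
  exact hy ⟨n, rfl⟩

theorem combWeight_binaryReduction (h : Fin 2 → ℂ) (w : ℤ → Letter) :
    combWeight h (binaryReduction ∘ w) = combWeight (letterWeight (h 1) (h 1) (h 0) (h 0)) w := by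
  funext y
  by_cases hy : y ∈ range (fun n : ℤ => (n : ℝ))
  · obtain ⟨n, rfl⟩ := hy
    rw [combWeight_intCast, combWeight_intCast]
    simp only [Function.comp]
    cases w n <;> rfl
  · rw [combWeight_of_notMem_range _ _ hy, combWeight_of_notMem_range _ _ hy]

/-- The coefficients of the dyadic square waves in the weights of a sign word. -/
noncomputable def waveCoeff (A B C D : ℂ) : ℕ → ℂ
  | 0 => (A - B + C - D) / 4
  | 1 => (A - C) / 2
  | _ + 2 => (B - D) / 2

/-- The shifts of the dyadic square waves in the weights of a sign word. -/
def waveShift : ℕ → ℤ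
  | 0 => 0
  | r + 1 => 1 - 2 ^ r

/-- For `j ≠ m` the argument is `2 ^ min j m` times an odd number, so `2 ^ (j + 1)` does not divide
it. For `j = m` it is `2 ^ (m + 1)` times `2 * k` or `2 * k + 1`, and `2 - s` is the resulting value
`1` or `-1`. -/
theorem dyadicWave_sub_two_pow {m j : ℕ} {k s : ℤ} (hs : s = 1 ∨ s = 3) :
    dyadicWave (j + 1) (2 ^ m * (4 * k + s) - 2 ^ j) =
      if j = m then (2 - s : ℂ) else 0 := by
  rcases lt_trichotomy j m with h | rfl | h
  · obtain ⟨i, rfl⟩ := Nat.exists_eq_add_of_lt h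
    rw [if_neg (by omega), dyadicWave_of_not_dvd]
    rw [show (2 : ℤ) ^ (j + i + 1) * (4 * k + s) - 2 ^ j =
      2 ^ j * (2 * (2 ^ i * (4 * k + s)) - 1) by ring, two_pow_succ_dvd_mul_iff]
    omega
  · rw [if_pos rfl]
    rcases hs with rfl | rfl
    · rw [show (2 : ℤ) ^ j * (4 * k + 1) - 2 ^ j = 2 ^ (j + 1) * (2 * k) by ring,
        dyadicWave_two_pow_mul, if_pos (even_two_mul k)]
      norm_num
    · rw [show (2 : ℤ) ^ j * (4 * k + 3) - 2 ^ j = 2 ^ (j + 1) * (2 * k + 1) by ring,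
        dyadicWave_two_pow_mul, if_neg (Int.not_even_two_mul_add_one k)]
      norm_num
  · obtain ⟨i, rfl⟩ := Nat.exists_eq_add_of_lt h
    rw [if_neg (by omega), dyadicWave_of_not_dvd]
    rw [show (2 : ℤ) ^ m * (4 * k + s) - 2 ^ (m + i + 1) =
      2 ^ m * (4 * k + s - 2 * 2 ^ i) by ring]
    intro hd
    have := two_pow_succ_dvd_mul_iff.1 (((pow_dvd_pow 2 (by omega)).trans hd :
      (2 : ℤ) ^ (m + 1) ∣ _))
    omega

theorem dyadicWave_zero (x : ℤ) : dyadicWave 0 x = if Even x then 1 else -1 := by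
  simpa using dyadicWave_two_pow_mul 0 x

theorem wavePartialSum_succ (d : ℂ) (c : ℕ → ℂ) (o : ℕ → ℤ) (p : ℕ) (x : ℤ) :
    wavePartialSum d c o (p + 1) x = d + c 0 * dyadicWave 0 (x + o 0) +
      ∑ r ∈ Finset.range p, c (r + 1) * dyadicWave (r + 1) (x + o (r + 1)) := by
  rw [wavePartialSum, Finset.sum_range_succ']
  ring

theorem wavePartialSum_waveShift (d : ℂ) (c : ℕ → ℂ) {x : ℤ} {m : ℕ} {k s : ℤ}
    (hs : s = 1 ∨ s = 3) (hx : x + 1 = 2 ^ m * (4 * k + s)) (p : ℕ) :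
    wavePartialSum d c waveShift (p + 1) x =
      d + c 0 * (if Even x then 1 else -1) + if m < p then c (m + 1) * (2 - s) else 0 := by
  have h : ∀ j, dyadicWave (j + 1) (x + waveShift (j + 1)) = if j = m then (2 - s : ℂ) else 0 := by
    intro j
    rw [← dyadicWave_sub_two_pow (k := k) hs, ← hx, waveShift]
    congr 1
    ring
  rw [wavePartialSum_succ, waveShift, add_zero, dyadicWave_zero]
  simp only [h, mul_ite, mul_zero, Finset.sum_ite_eq', Finset.mem_range]

/-- At `-1` the series need not equal the weight of the letter; the value is needed for the uniform
bound on partial sums. -/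
theorem wavePartialSum_waveShift_neg_one (d : ℂ) (c : ℕ → ℂ) (p : ℕ) :
    wavePartialSum d c waveShift (p + 1) (-1) = d - c 0 := by
  have h : ∀ j, dyadicWave (j + 1) (-1 + waveShift (j + 1)) = 0 := by
    intro j
    refine dyadicWave_of_not_dvd ?_
    rw [waveShift, show (-1 : ℤ) + (1 - 2 ^ j) = 2 ^ j * (-1) by ring, two_pow_succ_dvd_mul_iff]
    decide
  rw [wavePartialSum_succ, waveShift, add_zero, dyadicWave_zero]
  simp only [h, mul_zero, Finset.sum_const_zero]
  rw [if_neg (by decide)]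
  ring

theorem norm_wavePartialSum_waveShift_le {c : ℕ → ℂ} {K : ℝ} (hc : ∀ r, ‖c r‖ ≤ K) (d : ℂ)
    (p : ℕ) (x : ℤ) : ‖wavePartialSum d c waveShift (p + 1) x‖ ≤ ‖d‖ + K + K := by
  have hK : 0 ≤ K := (norm_nonneg _).trans (hc 0)
  by_cases hx : x = -1
  · subst hx
    rw [wavePartialSum_waveShift_neg_one]
    have := norm_sub_le d (c 0)
    linarith [hc 0]
  · obtain ⟨m, k, s, hs, h⟩ := exists_eq_two_pow_mul_four_mul_add (y := x + 1) (by omega)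
    rw [wavePartialSum_waveShift d c hs h]
    refine (norm_add_le _ _).trans (add_le_add ((norm_add_le _ _).trans
      (add_le_add le_rfl ?_)) ?_)
    · rw [norm_mul]
      refine (mul_le_of_le_one_right (norm_nonneg _) ?_).trans (hc 0)
      split_ifs <;> simp
    · split_ifs
      · rw [norm_mul]
        refine (mul_le_of_le_one_right (norm_nonneg _) ?_).trans (hc _)
        rcases hs with rfl | rfl <;> norm_num
      · simpa using hK

/-- The terms `d ± c 0` are the averages `(A + C) / 2` and `(B + D) / 2` over the two letters of
each parity; the surviving wave adds or subtracts half their difference. Non-divisibility forces `m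
< p`, so that wave occurs in the partial sum. -/
theorem letterWeight_signWord {P : Set ℤ} (hP : IsSignPattern P) (A B C D : ℂ) {p : ℕ} {x : ℤ}
    (hx : ¬ (2 : ℤ) ^ p ∣ x + 1) : letterWeight A B C D (signWord P x) =
      wavePartialSum ((A + B + C + D) / 4) (waveCoeff A B C D) waveShift (p + 1) x := by
  have hx0 : x + 1 ≠ 0 := fun h => hx (h ▸ dvd_zero _)
  obtain ⟨m, k, s, hs, h⟩ := exists_eq_two_pow_mul_four_mul_add hx0
  have hmp : m < p := by
    by_contra! hle
    exact hx (h ▸ (pow_dvd_pow 2 hle).mul_right _)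
  have hmem : x ∈ P ↔ s = 1 := by
    rw [hP.mem_iff (by omega)]
    rcases hs with rfl | rfl
    · exact iff_of_true (mem_signSet.2 ⟨m, k, h⟩) rfl
    · refine iff_of_false (fun h1 => ?_) (by norm_num)
      exact Set.disjoint_left.1 disjoint_signSet h1 (mem_signSet.2 ⟨m, k, h⟩)
  rw [wavePartialSum_waveShift _ _ hs h, if_pos hmp]
  rcases m with _ | m
  · have hxe : Even x := ⟨2 * k + (s - 1) / 2, by omega⟩
    rcases hs with rfl | rfl
    · simp only [signWord, hxe, hmem, if_true, letterWeight, waveCoeff]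
      push_cast
      ring
    · simp only [signWord, hxe, hmem, if_true, letterWeight, waveCoeff]
      norm_num
      ring
  · have hxe : ¬ Even x := by
      rw [Int.not_even_iff_odd]
      refine ⟨2 ^ m * (4 * k + s) - 1, ?_⟩
      rw [pow_succ, mul_comm _ (2 : ℤ), mul_assoc] at h
      omega
    rcases hs with rfl | rfl
    · simp only [signWord, hxe, hmem, if_true, if_false, letterWeight, waveCoeff]
      push_cast
      ring
    · simp only [signWord, hxe, hmem, if_false, letterWeight, waveCoeff]
      norm_num
      ring

theorem exists_norm_waveCoeff_le (A B C D : ℂ) : ∃ K, ∀ r, ‖waveCoeff A B C D r‖ ≤ K := by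
  refine ⟨‖(A - B + C - D) / 4‖ + ‖(A - C) / 2‖ + ‖(B - D) / 2‖, fun r => ?_⟩
  have h1 := norm_nonneg ((A - B + C - D) / 4)
  have h2 := norm_nonneg ((A - C) / 2)
  have h3 := norm_nonneg ((B - D) / 2)
  rcases r with _ | _ | r <;> simp only [waveCoeff] <;> linarith

theorem isAutocorrelation_signWord {P : Set ℤ} (hP : IsSignPattern P) (A B C D : ℂ) :
    IsAutocorrelation (combWeight (letterWeight A B C D) (signWord P))
      (intComb (waveCorrelation ((A + B + C + D) / 4) (waveCoeff A B C D))) := by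
  obtain ⟨K, hK⟩ := exists_norm_waveCoeff_le A B C D
  have hK0 : 0 ≤ K := (norm_nonneg _).trans (hK 0)
  set d := (A + B + C + D) / 4 with hd
  set K' := ‖A‖ + ‖B‖ + ‖C‖ + ‖D‖ + (‖d‖ + K + K) with hK'
  have hA := norm_nonneg A
  have hB := norm_nonneg B
  have hC := norm_nonneg C
  have hD := norm_nonneg D
  have hd0 := norm_nonneg d
  have hw : ∀ x, ‖letterWeight A B C D (signWord P x)‖ ≤ K' := by
    intro x
    cases signWord P x <;> simp only [letterWeight] <;> linarith
  refine isAutocorrelation_intComb (K := K') (h := fun x => letterWeight A B C D (signWord P x))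
    (combWeight_intCast _ _) (fun y => combWeight_of_notMem_range _ _) hw ?_
  refine hasMean_of_eq_wavePartialSum (o := waveShift) (a := 1) (K := K')
    (fun r => (hK r).trans (by linarith)) hw (fun p x => ?_)
    fun p x hx => letterWeight_signWord hP A B C D hx
  exact (norm_wavePartialSum_waveShift_le hK d p x).trans (by linarith)

/-! ### A Poisson formula for autocorrelations -/

theorem integral_eq_sum_intervalIntegral {F : ℝ → ℂ} (hF : Continuous F) {R : ℕ}
    (hR : ∀ x, F x ≠ 0 → |x| ≤ R) :
    ∫ x, F x = ∑ l ∈ Finset.Icc (-(R + 1 : ℕ) : ℤ) (R + 1 : ℕ), ∫ x in (0 : ℝ)..1, F (x + l) := by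
  have hcs : HasCompactSupport F :=
    HasCompactSupport.of_support_subset_isCompact (isCompact_Icc (a := -(R : ℝ)) (b := R))
      fun x hx => abs_le.1 (hR x hx)
  have h := (hF.integrable_of_hasCompactSupport hcs).hasSum_intervalIntegral_comp_add_int
  refine h.unique (hasSum_sum_of_ne_finset_zero fun l hl => ?_)
  rw [intervalIntegral.integral_of_le zero_le_one]
  refine setIntegral_eq_zero_of_forall_eq_zero fun x hx => ?_
  by_contra hne
  have h1 := abs_le.1 (hR _ hne)
  apply hl
  rw [Finset.mem_Icc]
  constructor
  · have : (-(R + 1 : ℕ) : ℝ) ≤ l := by push_cast; linarith [hx.1, hx.2, h1.1, h1.2]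
    exact_mod_cast this
  · have : (l : ℝ) ≤ (R + 1 : ℕ) := by push_cast; linarith [hx.1, hx.2, h1.1, h1.2]
    exact_mod_cast this

theorem selfConv_apply (g : C_c(ℝ, ℂ)) (t : ℝ) :
    selfConv g t = ∫ y, g y * conj (g (y - t)) := by
  change (g ⋆[ContinuousLinearMap.mul ℂ ℂ, volume] (tildeFun g)) t = _
  rw [convolution_def]
  refine integral_congr_ae (Eventually.of_forall fun y => ?_)
  change g y * conj (g (-(t - y))) = _
  rw [neg_sub]

theorem fourierInv_intCast_eq (g : C_c(ℝ, ℂ)) (n : ℤ) :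
    𝓕⁻ (fun x : ℝ => g x) (n : ℝ) =
      ∫ x : ℝ, fourier n (x : AddCircle (1 - 0 : ℝ)) * g x := by
  rw [Real.fourierInv_eq']
  refine integral_congr_ae (Eventually.of_forall fun x => ?_)
  simp only [fourier_coe_apply, smul_eq_mul]
  congr 2
  simp only [RCLike.inner_apply, conj_trivial, sub_zero]
  push_cast
  ring

theorem continuous_periodicSum (g : C_c(ℝ, ℂ)) (s : Finset ℤ) :
    Continuous fun x : ℝ => ∑ l ∈ s, g (x + l) :=
  continuous_finsetSum _ fun l _ => g.continuous.comp (by fun_prop)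

/-- Unfolding: the integral over the line splits into unit intervals, and the character of integer
frequency is unchanged by integer translations. -/
theorem fourierCoeffOn_periodicSum (g : C_c(ℝ, ℂ)) {R : ℕ} (hR : ∀ x, g x ≠ 0 → |x| ≤ R) (n : ℤ) :
    fourierCoeffOn (zero_lt_one (α := ℝ))
      (fun x => ∑ l ∈ Finset.Icc (-(R + 1 : ℕ) : ℤ) (R + 1 : ℕ), g (x + l)) n =
      𝓕⁻ (fun x : ℝ => g x) ((-n : ℤ) : ℝ) := by
  have hcont : Continuous fun x : ℝ => fourier (-n) (x : AddCircle (1 - 0 : ℝ)) * g x :=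
    ((fourier (-n)).continuous.comp (AddCircle.continuous_mk' _)).mul g.continuous
  rw [fourierInv_intCast_eq, fourierCoeffOn_eq_integral, integral_eq_sum_intervalIntegral hcont
    (R := R) fun x hx => hR x (right_ne_zero_of_mul hx)]
  rw [← intervalIntegral.integral_finsetSum]
  · rw [sub_zero, div_one, one_smul]
    refine intervalIntegral.integral_congr fun x _ => ?_
    simp only [smul_eq_mul, Finset.mul_sum]
    refine Finset.sum_congr rfl fun l _ => ?_
    congr 1
    rw [fourier_coe_apply, fourier_coe_apply, Complex.exp_eq_exp_iff_exists_int]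
    refine ⟨n * l, ?_⟩
    push_cast
    ring
  · intro l _
    exact (hcont.comp (continuous_id.add continuous_const)).intervalIntegrable _ _

theorem integral_norm_sq_periodicSum (g : C_c(ℝ, ℂ)) {R : ℕ} (hR : ∀ x, g x ≠ 0 → |x| ≤ R) :
    ((∫ x in (0 : ℝ)..1,
      ‖∑ l ∈ Finset.Icc (-(R + 1 : ℕ) : ℤ) (R + 1 : ℕ), g (x + l)‖ ^ 2 : ℝ) : ℂ) =
      ∑ᶠ m : ℤ, selfConv g m := by
  -- The bound `2 * (R + 1)`, rather than `2 * R`, ensures that for every `l` in the range below, `k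
  -- = l - m` with `|m|` up to this bound covers all `k` in that range.
  have hsupp : ∀ t, selfConv g t ≠ 0 → |t| ≤ (2 * (R + 1) : ℕ) := by
    intro t ht
    by_contra! hlt
    refine ht ?_
    rw [selfConv_apply]
    refine integral_eq_zero_of_ae (Eventually.of_forall fun y => ?_)
    by_contra hne
    have h1 := hR _ (left_ne_zero_of_mul hne)
    have h2 := hR (y - t) fun h => hne (by simp [h])
    have h3 := abs_sub y (y - t)
    rw [sub_sub_cancel] at h3
    push_cast at hlt
    linarith
  have hfin := finsum_intCast_eq_sum (η := fun _ => 1) hsupp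
  simp only [one_mul] at hfin
  have hc1 : ∀ l : ℤ, Continuous fun x : ℝ => g (x + l) := fun l => g.continuous.comp (by fun_prop)
  have hc2 : ∀ k l : ℤ, Continuous fun x : ℝ => g (x + l) * conj (g (x + k)) := fun k l =>
    (hc1 l).mul (Complex.continuous_conj.comp (hc1 k))
  have hG : ∀ m : ℤ, selfConv g m = ∑ l ∈ Finset.Icc (-(R + 1 : ℕ) : ℤ) (R + 1 : ℕ),
      ∫ x in (0 : ℝ)..1, g (x + l) * conj (g (x + (l - m : ℤ))) := by
    intro m
    rw [selfConv_apply, integral_eq_sum_intervalIntegral (R := R)]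
    · refine Finset.sum_congr rfl fun l _ => ?_
      push_cast
      simp only [add_sub_assoc]
    · exact g.continuous.mul (Complex.continuous_conj.comp (g.continuous.comp (by fun_prop)))
    · exact fun x hx => hR x (left_ne_zero_of_mul hx)
  rw [hfin, ← intervalIntegral.integral_ofReal]
  simp only [hG]
  rw [Finset.sum_comm]
  have hsq : ∀ x : ℝ, (((‖∑ l ∈ Finset.Icc (-(R + 1 : ℕ) : ℤ) (R + 1 : ℕ), g (x + l)‖ ^ 2 : ℝ)) : ℂ)
      = ∑ l ∈ Finset.Icc (-(R + 1 : ℕ) : ℤ) (R + 1 : ℕ),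
        ∑ k ∈ Finset.Icc (-(R + 1 : ℕ) : ℤ) (R + 1 : ℕ), g (x + l) * conj (g (x + k)) := by
    intro x
    rw [← Complex.normSq_eq_norm_sq, ← Complex.mul_conj, map_sum, Finset.sum_mul_sum]
  simp only [hsq]
  rw [intervalIntegral.integral_finsetSum fun l _ =>
    (continuous_finsetSum _ fun k _ => hc2 k l).intervalIntegrable _ _]
  refine Finset.sum_congr rfl fun l hl => ?_
  rw [intervalIntegral.integral_finsetSum fun k _ => (hc2 k l).intervalIntegrable _ _]
  rw [Finset.mem_Icc] at hl
  symm
  have hz : ∀ k : ℤ, k ∉ Finset.Icc (-(R + 1 : ℕ) : ℤ) (R + 1 : ℕ) →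
      ∫ x in (0 : ℝ)..1, g (x + l) * conj (g (x + k)) = 0 := by
    intro k hk
    rw [intervalIntegral.integral_of_le zero_le_one]
    refine setIntegral_eq_zero_of_forall_eq_zero fun x hx => ?_
    by_contra hne
    have h1 := abs_le.1 (hR (x + k) fun h => hne (by simp [h]))
    apply hk
    rw [Finset.mem_Icc]
    constructor
    · have : (-(R + 1 : ℕ) : ℝ) ≤ k := by push_cast; linarith [hx.1, hx.2, h1.1, h1.2]
      exact_mod_cast this
    · have : (k : ℝ) ≤ (R + 1 : ℕ) := by push_cast; linarith [hx.1, hx.2, h1.1, h1.2]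
      exact_mod_cast this
  have hsub : Finset.Icc (-(R + 1 : ℕ) : ℤ) (R + 1 : ℕ) ⊆
      Finset.Icc (l - (2 * (R + 1) : ℕ)) (l + (2 * (R + 1) : ℕ)) := by
    refine Finset.Icc_subset_Icc ?_ ?_ <;> push_cast at hl ⊢ <;> omega
  rw [Finset.sum_subset hsub fun k _ hk => hz k hk]
  refine Finset.sum_nbij' (fun m => l - m) (fun k => l - k) ?_ ?_ ?_ ?_ fun _ _ => rfl <;>
    intro m hm <;> simp only [Finset.mem_Icc] at * <;> omega

/-- This is Parseval's identity for the periodisation of `g`: its Fourier coefficients sample `𝓕⁻ g`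
at integers, and its squared norm sums `g * g~` over the integers. -/
theorem exists_hasSum_fourierInv_intCast (g : C_c(ℝ, ℂ)) :
    ∃ s : ℝ, HasSum (fun n : ℤ => ‖𝓕⁻ (fun x : ℝ => g x) (n : ℝ)‖ ^ 2) s ∧
      (s : ℂ) = ∑ᶠ m : ℤ, selfConv g m := by
  obtain ⟨R, hR⟩ := exists_nat_forall_ne_zero_abs_le g
  have hcont := continuous_periodicSum g (Finset.Icc (-(R + 1 : ℕ) : ℤ) (R + 1 : ℕ))
  have hL2 : MemLp (fun x : ℝ => ∑ l ∈ Finset.Icc (-(R + 1 : ℕ) : ℤ) (R + 1 : ℕ), g (x + l)) 2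
      (volume.restrict (Ioc 0 1)) := by
    rw [memLp_two_iff_integrable_sq_norm hcont.aestronglyMeasurable]
    exact (hcont.norm.pow 2).integrableOn_Ioc
  have h := hasSum_sq_fourierCoeffOn zero_lt_one hL2
  simp only [fourierCoeffOn_periodicSum g hR] at h
  rw [sub_zero, inv_one, one_smul] at h
  exact ⟨_, (Equiv.neg ℤ).hasSum_iff.1 h, integral_norm_sq_periodicSum g hR⟩

/-- The function `x ↦ g (q * x)`. -/
noncomputable def dilate (g : C_c(ℝ, ℂ)) (q : ℝ) (hq : q ≠ 0) : C_c(ℝ, ℂ) where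
  toFun x := g (q * x)
  continuous_toFun := g.continuous.comp (continuous_const_mul q)
  hasCompactSupport' := g.hasCompactSupport.comp_homeomorph (Homeomorph.mulLeft₀ q hq)

theorem dilate_apply (g : C_c(ℝ, ℂ)) (q : ℝ) (hq : q ≠ 0) (x : ℝ) : dilate g q hq x = g (q * x) :=
  rfl

theorem selfConv_dilate (g : C_c(ℝ, ℂ)) {q : ℝ} (hq : 0 < q) (t : ℝ) :
    selfConv (dilate g q hq.ne') t = (q : ℂ)⁻¹ * selfConv g (q * t) := by
  have := Measure.integral_comp_mul_left (fun y => g y * conj (g (y - q * t))) q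
  rw [selfConv_apply, selfConv_apply]
  simp only [dilate_apply, mul_sub]
  rw [this, abs_of_pos (inv_pos.2 hq), Complex.real_smul, Complex.ofReal_inv]

theorem fourierInv_dilate (g : C_c(ℝ, ℂ)) {q : ℝ} (hq : 0 < q) (t : ℝ) :
    𝓕⁻ (fun x : ℝ => dilate g q hq.ne' x) t = (q : ℂ)⁻¹ * 𝓕⁻ (fun x : ℝ => g x) (t / q) := by
  rw [Real.fourierInv_eq', Real.fourierInv_eq']
  have := Measure.integral_comp_mul_left
    (fun y : ℝ => Complex.exp (((2 * Real.pi * inner ℝ y (t / q) : ℝ) : ℂ) * Complex.I) • g y) q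
  rw [abs_of_pos (inv_pos.2 hq), Complex.real_smul, Complex.ofReal_inv] at this
  rw [← this]
  refine integral_congr_ae (Eventually.of_forall fun x => ?_)
  simp only [dilate_apply, RCLike.inner_apply, conj_trivial]
  congr 5
  field_simp

theorem finsum_two_pow_mul (r : ℕ) (G : ℝ → ℂ) :
    ∑ᶠ l : ℤ, G ((2 : ℝ) ^ r * l) = ∑ᶠ m : ℤ, dyadicInd r m * G m := by
  have hinj : Function.Injective fun l : ℤ => (2 : ℤ) ^ r * l :=
    mul_right_injective₀ (by positivity)
  have h := finsum_mem_range (f := fun m : ℤ => G m) hinj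
  push_cast at h
  rw [← h]
  refine finsum_congr fun m => ?_
  have hm : m ∈ range (fun l : ℤ => (2 : ℤ) ^ r * l) ↔ (2 : ℤ) ^ r ∣ m :=
    ⟨fun ⟨l, hl⟩ => ⟨l, hl.symm⟩, fun ⟨l, hl⟩ => ⟨l, hl.symm⟩⟩
  simp only [hm, finsum_eq_if, dyadicInd, ite_mul, one_mul, zero_mul]

/-- Apply the integer case to `x ↦ g (q * x)` with `q = 2 ^ r`. The squared transforms scale by `q ^
(-2)` and the self-convolution by `q ^ (-1)`, which leaves the factor `q`. -/
theorem exists_hasSum_fourierInv_div_two_pow (g : C_c(ℝ, ℂ)) (r : ℕ) :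
    ∃ s : ℝ, HasSum (fun n : ℤ => ‖𝓕⁻ (fun x : ℝ => g x) ((n : ℝ) / 2 ^ r)‖ ^ 2) s ∧
      (s : ℂ) = 2 ^ r * intComb (dyadicInd r) (selfConv g) := by
  have hq : (0 : ℝ) < 2 ^ r := by positivity
  obtain ⟨s, hs, hs'⟩ := exists_hasSum_fourierInv_intCast (dilate g _ hq.ne')
  refine ⟨(2 ^ r) ^ 2 * s, ?_, ?_⟩
  · have e : ∀ n : ℤ, ‖𝓕⁻ (fun x : ℝ => g x) ((n : ℝ) / 2 ^ r)‖ ^ 2 =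
        (2 ^ r) ^ 2 * ‖𝓕⁻ (fun x : ℝ => dilate g _ hq.ne' x) (n : ℝ)‖ ^ 2 := fun n => by
      rw [fourierInv_dilate g hq, norm_mul, mul_pow, norm_inv, Complex.norm_real,
        Real.norm_eq_abs, abs_of_pos hq]
      field_simp
    rw [funext e]
    exact hs.mul_left _
  · change _ = 2 ^ r * ∑ᶠ m : ℤ, dyadicInd r m * selfConv g m
    rw [← finsum_two_pow_mul]
    simp only [selfConv_dilate g hq] at hs'
    rw [← mul_finsum] at hs'
    push_cast at hs' ⊢
    rw [hs']
    have : (2 : ℂ) ^ r ≠ 0 := pow_ne_zero _ two_ne_zero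
    field_simp

/-! ### The Fourier transform of the autocorrelation -/

/-- Reindexing by the order of the wave puts all three families of atoms into one form. With
nonnegative extended values the sums may be rearranged freely. -/
theorem lintegral_paperSpectrum (A B C D : ℂ) (F : ℝ → ENNReal) :
    ∫⁻ k, F k ∂(paperSpectrum A B C D) =
      ENNReal.ofReal (‖(A + B + C + D) / 4‖ ^ 2) * ∑' n : ℤ, F n +
      ∑' r : ℕ, ENNReal.ofReal (‖waveCoeff A B C D r‖ ^ 2 / 4 ^ r) *
        ∑' m : {m : ℤ // Odd m}, F ((m : ℤ) / 2 ^ (r + 1)) := by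
  let e : ℕ ≃ {r : ℕ // 3 ≤ r} :=
    { toFun := fun r => ⟨r + 3, by omega⟩
      invFun := fun r => r - 3
      left_inv := fun r => by simp
      right_inv := fun r => by ext; simp [Nat.sub_add_cancel r.2] }
  simp only [paperSpectrum, lintegral_add_measure, lintegral_smul_measure, lintegral_sum_measure,
    lintegral_dirac, smul_eq_mul]
  congr 1
  rw [ENNReal.summable.tsum_add ENNReal.summable, ENNReal.summable.tsum_add ENNReal.summable,
    tsum_eq_zero_add' ENNReal.summable, tsum_eq_zero_add' ENNReal.summable, ENNReal.tsum_comm,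
    ← e.tsum_eq, ENNReal.tsum_mul_left, ENNReal.tsum_mul_left, ← add_assoc]
  congr 1
  · congr 1
    · simp [waveCoeff]
    · congr 1
      · simp only [waveCoeff, norm_div]
        congr 1
        norm_num
        ring
      · norm_num
  · refine tsum_congr fun r => ?_
    rw [ENNReal.tsum_mul_left]
    congr 1
    simp only [waveCoeff, norm_div, norm_pow, Complex.norm_ofNat, e, Equiv.coe_fn_mk]
    congr 1
    have h4 : (4 : ℝ) ^ (r + 2) = (2 ^ (r + 2)) ^ 2 := by
      rw [← pow_mul, mul_comm, pow_mul]
      norm_num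
    rw [h4]
    field_simp
    ring

theorem hasSum_odd_of_hasSum_two_mul {F : ℤ → ℝ} {s t : ℝ} (hs : HasSum (fun n => F (2 * n)) s)
    (ht : HasSum F t) : HasSum (fun m : {m : ℤ // Odd m} => F m) (t - s) := by
  have heven : HasSum (F ∘ ((↑) : ({m : ℤ | Odd m}ᶜ : Set ℤ) → ℤ)) s := by
    rw [hasSum_subtype_iff_indicator]
    have hinj : Function.Injective fun l : ℤ => 2 * l := mul_right_injective₀ two_ne_zero
    rw [← hinj.hasSum_iff]
    · have e : ({m : ℤ | Odd m}ᶜ.indicator F ∘ fun l => 2 * l) = fun n : ℤ => F (2 * n) := by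
        funext n
        have : 2 * n ∈ {m : ℤ | Odd m}ᶜ := by
          rw [mem_compl_iff, mem_ofPred_eq, Int.not_odd_iff_even]
          exact even_two_mul n
        rw [Function.comp, indicator_of_mem this]
      rwa [e]
    · intro x hx
      refine indicator_of_notMem (fun hx' => hx ?_) _
      rw [mem_compl_iff, mem_ofPred_eq, Int.not_odd_iff_even, even_iff_two_dvd] at hx'
      obtain ⟨l, rfl⟩ := hx'
      exact ⟨l, rfl⟩
  obtain ⟨u, hu⟩ : Summable (F ∘ ((↑) : {m : ℤ | Odd m} → ℤ)) := ht.summable.subtype _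
  rw [← (hu.add_compl heven).unique ht, add_sub_cancel_right]
  exact hu

theorem hasSum_odd_div_two_pow {F : ℝ → ℝ} {s t : ℝ} {r : ℕ}
    (hs : HasSum (fun n : ℤ => F ((n : ℝ) / 2 ^ r)) s)
    (ht : HasSum (fun n : ℤ => F ((n : ℝ) / 2 ^ (r + 1))) t) :
    HasSum (fun m : {m : ℤ // Odd m} => F (((m : ℤ) : ℝ) / 2 ^ (r + 1))) (t - s) := by
  refine hasSum_odd_of_hasSum_two_mul (F := fun n : ℤ => F ((n : ℝ) / 2 ^ (r + 1))) ?_ ht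
  have e : ∀ n : ℤ, ((2 * n : ℤ) : ℝ) / 2 ^ (r + 1) = n / 2 ^ r := fun n => by
    rw [pow_succ]
    push_cast
    field_simp
  simpa only [e] using hs

/-- Fractions with denominator `2 ^ (r + 1)` and even numerator are those with denominator `2 ^ r`;
subtracting the two Poisson formulas leaves the odd numerators and the wave. -/
theorem exists_hasSum_fourierInv_odd (g : C_c(ℝ, ℂ)) (r : ℕ) :
    ∃ s : ℝ, HasSum (fun m : {m : ℤ // Odd m} =>
        ‖𝓕⁻ (fun x : ℝ => g x) (((m : ℤ) : ℝ) / 2 ^ (r + 1))‖ ^ 2) s ∧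
      (s : ℂ) = 2 ^ r * intComb (dyadicWave r) (selfConv g) := by
  obtain ⟨s, hs, hs'⟩ := exists_hasSum_fourierInv_div_two_pow g r
  obtain ⟨t, ht, ht'⟩ := exists_hasSum_fourierInv_div_two_pow g (r + 1)
  refine ⟨t - s, hasSum_odd_div_two_pow (F := fun k => ‖𝓕⁻ (fun x : ℝ => g x) k‖ ^ 2) hs ht, ?_⟩
  push_cast
  rw [hs', ht']
  change 2 ^ (r + 1) * ∑ᶠ m : ℤ, dyadicInd (r + 1) m * selfConv g m -
    2 ^ r * ∑ᶠ m : ℤ, dyadicInd r m * selfConv g m =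
    2 ^ r * ∑ᶠ m : ℤ, dyadicWave r m * selfConv g m
  obtain ⟨R, hR⟩ := exists_nat_forall_ne_zero_abs_le (selfConv g)
  rw [finsum_intCast_eq_sum hR, finsum_intCast_eq_sum hR, finsum_intCast_eq_sum hR,
    Finset.mul_sum, Finset.mul_sum, Finset.mul_sum, ← Finset.sum_sub_distrib]
  refine Finset.sum_congr rfl fun m _ => ?_
  rw [dyadicWave]
  ring

theorem isFourierTransformOf_paperSpectrum (A B C D : ℂ) :
    IsFourierTransformOf (paperSpectrum A B C D)
      (intComb (waveCorrelation ((A + B + C + D) / 4) (waveCoeff A B C D))) := by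
  intro g
  obtain ⟨K, hK⟩ := exists_norm_waveCoeff_le A B C D
  set d := (A + B + C + D) / 4 with hd
  set c := waveCoeff A B C D with hc
  set F : ℝ → ℝ := fun k => ‖𝓕⁻ (fun x : ℝ => g x) k‖ ^ 2 with hF
  have hF0 : ∀ k, 0 ≤ F k := fun k => by positivity
  obtain ⟨s, hs, hs'⟩ := exists_hasSum_fourierInv_div_two_pow g 0
  choose o ho ho' using exists_hasSum_fourierInv_odd g
  have ho0 : ∀ r, 0 ≤ o r := fun r => (ho r).nonneg fun m => hF0 _
  have hs0 : 0 ≤ s := hs.nonneg fun m => hF0 _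
  obtain ⟨R, hR⟩ := exists_nat_forall_ne_zero_abs_le (selfConv g)
  have hterm : ∀ r : ℕ, (((‖c r‖ ^ 2 / 4 ^ r * o r : ℝ)) : ℂ) = ∑ m ∈ Finset.Icc (-R : ℤ) R,
      (‖c r‖ ^ 2 : ℝ) * (((2 : ℂ) ^ r)⁻¹ * dyadicWave r m) * selfConv g m := by
    intro r
    have h1 : intComb (dyadicWave r) (selfConv g) = ∑ m ∈ Finset.Icc (-R : ℤ) R,
      dyadicWave r m * selfConv g m := finsum_intCast_eq_sum hR
    rw [Complex.ofReal_mul, ho', h1, Finset.mul_sum, Finset.mul_sum]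
    refine Finset.sum_congr rfl fun m _ => ?_
    have h2 : (2 : ℂ) ^ r ≠ 0 := pow_ne_zero _ two_ne_zero
    have h4 : (4 : ℂ) ^ r = 2 ^ r * 2 ^ r := by rw [← mul_pow]; norm_num
    push_cast
    rw [h4]
    field_simp
  -- Only finitely many `m` meet the support of the self-convolution, so the series over `r` may be
  -- summed separately for each `m`.
  have hsum : HasSum (fun r : ℕ => (((‖c r‖ ^ 2 / 4 ^ r * o r : ℝ)) : ℂ))
      (∑ m ∈ Finset.Icc (-R : ℤ) R,
        (∑' r : ℕ, (‖c r‖ ^ 2 : ℝ) * (((2 : ℂ) ^ r)⁻¹ * dyadicWave r m)) * selfConv g m) := by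
    simp only [hterm]
    exact hasSum_sum fun m _ => (summable_waveCorrelation hK m).hasSum.mul_right _
  have hsumR : Summable fun r : ℕ => ‖c r‖ ^ 2 / 4 ^ r * o r := by
    exact_mod_cast hsum.summable
  set T := ‖d‖ ^ 2 * s + ∑' r : ℕ, ‖c r‖ ^ 2 / 4 ^ r * o r with hT
  have hT0 : 0 ≤ T := add_nonneg (by positivity)
    (tsum_nonneg fun r => mul_nonneg (by positivity) (ho0 r))
  have hTγ : (T : ℂ) = intComb (waveCorrelation d c) (selfConv g) := by
    have h1 : intComb (waveCorrelation d c) (selfConv g) = ∑ m ∈ Finset.Icc (-R : ℤ) R,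
      waveCorrelation d c m * selfConv g m := finsum_intCast_eq_sum hR
    have h2 : intComb (dyadicInd 0) (selfConv g) = ∑ m ∈ Finset.Icc (-R : ℤ) R,
      dyadicInd 0 m * selfConv g m := finsum_intCast_eq_sum hR
    rw [h1, hT, Complex.ofReal_add, Complex.ofReal_tsum, hsum.tsum_eq, Complex.ofReal_mul, hs', h2]
    simp only [waveCorrelation, add_mul, Finset.sum_add_distrib, dyadicInd_zero, Finset.mul_sum]
    simp only [pow_zero, one_mul]
  -- The lower integral is computed first: its finiteness gives integrability, and it then gives the
  -- value of the Bochner integral.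
  have hlint : ∫⁻ k, ENNReal.ofReal (F k) ∂(paperSpectrum A B C D) = ENNReal.ofReal T := by
    rw [lintegral_paperSpectrum, hT, ENNReal.ofReal_add (by positivity)
      (tsum_nonneg fun r => mul_nonneg (by positivity) (ho0 r)), ENNReal.ofReal_mul (by positivity),
      ENNReal.ofReal_tsum_of_nonneg (fun r => mul_nonneg (by positivity) (ho0 r)) hsumR]
    congr 2
    · rw [← hs.tsum_eq, ENNReal.ofReal_tsum_of_nonneg (fun _ => hF0 _) hs.summable]
      simp only [pow_zero, div_one, hF]
    · funext r
      rw [ENNReal.ofReal_mul (by positivity), ← (ho r).tsum_eq,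
        ENNReal.ofReal_tsum_of_nonneg (fun _ => hF0 _) (ho r).summable]
  have hcont : Continuous F := by
    have hg : Integrable (fun x : ℝ => g x) := g.continuous.integrable_of_hasCompactSupport
      g.hasCompactSupport
    have : Continuous (𝓕 (fun x : ℝ => g x)) :=
      VectorFourier.fourierIntegral_continuous Real.continuous_fourierChar
        (by exact continuous_inner) hg
    refine (Continuous.norm ?_).pow 2
    have h2 : 𝓕⁻ (fun x : ℝ => g x) = fun k => 𝓕 (fun x : ℝ => g x) (-k) :=
      funext fun k => Real.fourierInv_eq_fourier_neg _ k
    rw [h2]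
    exact this.comp continuous_neg
  constructor
  · refine ⟨hcont.aestronglyMeasurable, ?_⟩
    rw [hasFiniteIntegral_iff_ofReal (Eventually.of_forall hF0), hlint]
    exact ENNReal.ofReal_lt_top
  · rw [integral_eq_lintegral_of_nonneg_ae (Eventually.of_forall hF0) hcont.aestronglyMeasurable,
      hlint, ENNReal.toReal_ofReal hT0, hTγ]

/-- All atoms sit at rational numbers. -/
theorem isPurePoint_paperSpectrum (A B C D : ℂ) : IsPurePoint (paperSpectrum A B C D) := by
  refine ⟨range ((↑) : ℚ → ℝ), countable_range _, ?_⟩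
  have hq : ∀ q : ℚ, (q : ℝ) ∉ (range ((↑) : ℚ → ℝ))ᶜ := fun q hq => hq ⟨q, rfl⟩
  have h1 : ∀ n : ℤ, (n : ℝ) ∉ (range ((↑) : ℚ → ℝ))ᶜ := fun n => by simpa using hq n
  have h2 : ∀ (n : ℤ) (r : ℕ), (n : ℝ) / 2 ^ r ∉ (range ((↑) : ℚ → ℝ))ᶜ := fun n r => by
    simpa using hq (n / 2 ^ r)
  have hm : MeasurableSet (range ((↑) : ℚ → ℝ))ᶜ := (countable_range _).measurableSet.compl
  rw [← lintegral_indicator_one hm, lintegral_paperSpectrum]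
  simp [indicator_of_notMem (h1 _), indicator_of_notMem (h2 _ _)]

theorem hasDiffraction_signWord {P : Set ℤ} (hP : IsSignPattern P) (A B C D : ℂ) :
    HasDiffraction (combWeight (letterWeight A B C D) (signWord P)) (paperSpectrum A B C D) :=
  ⟨_, isAutocorrelation_signWord hP A B C D, isFourierTransformOf_paperSpectrum A B C D⟩

theorem isPurePointDiffractive_signWord {P : Set ℤ} (hP : IsSignPattern P) (A B C D : ℂ) :
    IsPurePointDiffractive (combWeight (letterWeight A B C D) (signWord P)) :=
  ⟨_, hasDiffraction_signWord hP A B C D, isPurePoint_paperSpectrum A B C D⟩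

/-! ### The main theorem -/

theorem isSignPattern_of_mem {w : ℤ → Letter}
    (hw : w ∈ ({signWord (signSet 1 ∪ {-1}), signWord (signSet 1)} : Set (ℤ → Letter))) :
    ∃ P, IsSignPattern P ∧ w = signWord P := by
  rcases hw with rfl | rfl
  · exact ⟨_, isSignPattern_signSet_union, rfl⟩
  · exact ⟨_, isSignPattern_signSet, rfl⟩

theorem odd_inter_signSet_union {s : ℤ} :
    {n : ℤ | ¬ Even n} ∩ (signSet s ∪ {-1}) = {n : ℤ | ¬ Even n} ∩ signSet s ∪ {-1} := by
  rw [inter_union_distrib_left, inter_eq_self_of_subset_right (t := {-1})]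
  rw [singleton_subset_iff]
  decide

theorem even_inter_signSet_union {s : ℤ} :
    {n : ℤ | Even n} ∩ (signSet s ∪ {-1}) = {n : ℤ | Even n} ∩ signSet s := by
  ext n
  simp only [mem_inter_iff, mem_union, mem_singleton_iff, mem_ofPred_eq]
  constructor
  · rintro ⟨h, h' | rfl⟩
    · exact ⟨h, h'⟩
    · exact absurd h (by decide)
  · tauto

theorem even_inter_signSet_nonempty {s : ℤ} (hs : s = 1 ∨ s = 3) :
    ({n : ℤ | Even n} ∩ signSet s).Nonempty := by
  refine ⟨s - 1, ?_, mem_signSet.2 ⟨0, 0, by ring⟩⟩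
  rcases hs with rfl | rfl <;> decide

theorem odd_inter_signSet_nonempty {s : ℤ} (hs : s = 1 ∨ s = 3) :
    ({n : ℤ | ¬ Even n} ∩ signSet s).Nonempty := by
  refine ⟨2 * s - 1, ?_, mem_signSet.2 ⟨1, 0, by ring⟩⟩
  rcases hs with rfl | rfl <;> decide

theorem intCast_mem_compl_padicEven {n : ℤ} :
    (n : ℤ_[2]) ∈ padicEvenᶜ ↔ n ∈ {n : ℤ | ¬ Even n} := by
  rw [mem_compl_iff, intCast_mem_padicEven]
  rfl

theorem isRegularModelSet_even {s : ℤ} (hs : s = 1 ∨ s = 3) :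
    IsRegularModelSet physicalMap starMap 0 (twoAdicClosure ({n : ℤ | Even n} ∩ signSet s))
      ((fun n : ℤ => (n : ℝ)) '' ({n : ℤ | Even n} ∩ signSet s)) :=
  isRegularModelSet_clopen isClopen_padicEven (fun _ => intCast_mem_padicEven) hs
    neg_one_notMem_padicEven (even_inter_signSet_nonempty hs) rfl

theorem isRegularModelSet_odd_union {s : ℤ} (hs : s = 1 ∨ s = 3) :
    IsRegularModelSet physicalMap starMap 0
      (twoAdicClosure ({n : ℤ | ¬ Even n} ∩ signSet s ∪ {-1}))
      ((fun n : ℤ => (n : ℝ)) '' ({n : ℤ | ¬ Even n} ∩ signSet s ∪ {-1})) :=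
  isRegularModelSet_clopen_union isClopen_padicEven.compl (fun _ => intCast_mem_compl_padicEven) hs
    (odd_inter_signSet_nonempty hs) rfl

theorem isRegularModelSet_odd_diff {s : ℤ} (hs : s = 1 ∨ s = 3) :
    IsRegularModelSet physicalMap starMap 0
      (twoAdicClosure ({n : ℤ | ¬ Even n} ∩ signSet s) \ {-1})
      ((fun n : ℤ => (n : ℝ)) '' ({n : ℤ | ¬ Even n} ∩ signSet s)) :=
  isRegularModelSet_clopen_diff isClopen_padicEven.compl (fun _ => intCast_mem_compl_padicEven) hs
    (odd_inter_signSet_nonempty hs) rfl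

theorem isRegularModelSet_signSet_union {s : ℤ} (hs : s = 1 ∨ s = 3) :
    IsRegularModelSet physicalMap starMap 0 (twoAdicClosure (signSet s ∪ {-1}))
      ((fun n : ℤ => (n : ℝ)) '' (signSet s ∪ {-1})) :=
  isRegularModelSet_clopen_union (E := univ) (R := univ) isClopen_univ (fun _ => by simp) hs
    (by simpa using (even_inter_signSet_nonempty hs).right) (by simp)

theorem isRegularModelSet_signSet_diff {s : ℤ} (hs : s = 1 ∨ s = 3) :
    IsRegularModelSet physicalMap starMap 0 (twoAdicClosure (signSet s) \ {-1})
      ((fun n : ℤ => (n : ℝ)) '' signSet s) :=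
  isRegularModelSet_clopen_diff (E := univ) (R := univ) isClopen_univ (fun _ => by simp) hs
    (by simpa using (even_inter_signSet_nonempty hs).right) (by simp)

theorem mainTheorem1 :
    ∃ w₁ w₂ : ℤ → Letter,
      -- the two bi-infinite fixed points
      w₁ ≠ w₂ ∧ {w | applySubst sigma w = w} = {w₁, w₂} ∧
      w₁ (-1) = .b ∧ w₁ 0 = .a ∧ IsLimitOfSeed sigma .b .a w₁ ∧
      w₂ (-1) = .d ∧ w₂ 0 = .a ∧ IsLimitOfSeed sigma .d .a w₂ ∧
      -- their type sets
      typeSet w₁ .a = residueClass 4 0 ∧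
      typeSet w₁ .c = residueClass 4 2 ∧
      typeSet w₁ .b = (⋃ m : ℕ, ⋃ _ : 1 ≤ m, residueClass (2 ^ (m + 2)) (2 ^ m - 1)) ∪ {-1} ∧
      typeSet w₁ .d = (⋃ m : ℕ, ⋃ _ : 1 ≤ m, residueClass (2 ^ (m + 2)) (3 * 2 ^ m - 1)) ∧
      typeSet w₂ .a = residueClass 4 0 ∧
      typeSet w₂ .c = residueClass 4 2 ∧
      typeSet w₂ .b = (⋃ m : ℕ, ⋃ _ : 1 ≤ m, residueClass (2 ^ (m + 2)) (2 ^ m - 1)) ∧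
      typeSet w₂ .d =
        (⋃ m : ℕ, ⋃ _ : 1 ≤ m, residueClass (2 ^ (m + 2)) (3 * 2 ^ m - 1)) ∪ {-1} ∧
      -- the type sets are regular model sets
      (∀ x : Letter, x ≠ .d → IsRegularModelSet physicalMap starMap 0
        (twoAdicClosure (typeSet w₁ x)) (pointSet w₁ x)) ∧
      IsRegularModelSet physicalMap starMap 0
        (twoAdicClosure (typeSet w₁ .d) \ {-1}) (pointSet w₁ .d) ∧
      (∀ x : Letter, x ≠ .b → IsRegularModelSet physicalMap starMap 0
        (twoAdicClosure (typeSet w₂ x)) (pointSet w₂ x)) ∧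
      IsRegularModelSet physicalMap starMap 0
        (twoAdicClosure (typeSet w₂ .b) \ {-1}) (pointSet w₂ .b) ∧
      -- the diffraction of the weighted Dirac combs
      (∀ w ∈ ({w₁, w₂} : Set (ℤ → Letter)), ∀ A B C D : ℂ,
        HasDiffraction (combWeight (letterWeight A B C D) w) (paperSpectrum A B C D) ∧
        IsPurePointDiffractive (combWeight (letterWeight A B C D) w)) ∧
      -- the binary reductions are regular model sets
      typeSet (binaryReduction ∘ w₁) 1 =
        (⋃ m : ℕ, residueClass (2 ^ (m + 2)) (2 ^ m - 1)) ∪ {-1} ∧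
      typeSet (binaryReduction ∘ w₁) 0 =
        (⋃ m : ℕ, residueClass (2 ^ (m + 2)) (3 * 2 ^ m - 1)) ∧
      typeSet (binaryReduction ∘ w₂) 1 =
        (⋃ m : ℕ, residueClass (2 ^ (m + 2)) (2 ^ m - 1)) ∧
      typeSet (binaryReduction ∘ w₂) 0 =
        (⋃ m : ℕ, residueClass (2 ^ (m + 2)) (3 * 2 ^ m - 1)) ∪ {-1} ∧
      IsRegularModelSet physicalMap starMap 0
        (twoAdicClosure (typeSet (binaryReduction ∘ w₁) 1)) (pointSet (binaryReduction ∘ w₁) 1) ∧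
      IsRegularModelSet physicalMap starMap 0
        (twoAdicClosure (typeSet (binaryReduction ∘ w₁) 0) \ {-1})
        (pointSet (binaryReduction ∘ w₁) 0) ∧
      IsRegularModelSet physicalMap starMap 0
        (twoAdicClosure (typeSet (binaryReduction ∘ w₂) 0)) (pointSet (binaryReduction ∘ w₂) 0) ∧
      IsRegularModelSet physicalMap starMap 0
        (twoAdicClosure (typeSet (binaryReduction ∘ w₂) 1) \ {-1})
        (pointSet (binaryReduction ∘ w₂) 1) ∧
      -- the diffraction of the binary reductions
      (∀ w ∈ ({w₁, w₂} : Set (ℤ → Letter)), ∀ h : Fin 2 → ℂ,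
        HasDiffraction (combWeight h (binaryReduction ∘ w))
          (paperSpectrum (h 1) (h 1) (h 0) (h 0)) ∧
        IsPurePointDiffractive (combWeight h (binaryReduction ∘ w))) := by
  have hP₁ := isSignPattern_signSet_union
  have hP₂ := isSignPattern_signSet
  have hn := neg_one_notMem_signSet (s := 1) odd_one
  have h₁ : signWord (signSet 1 ∪ {-1}) (-1) = .b := signWord_neg_one_of_mem (by simp)
  have h₂ : signWord (signSet 1) (-1) = .d := signWord_neg_one_of_notMem hn
  obtain ⟨a₁, b₁, c₁, d₁⟩ := typeSet_signWord (signSet 1 ∪ {-1})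
  obtain ⟨a₂, b₂, c₂, d₂⟩ := typeSet_signWord (signSet 1)
  obtain ⟨o₁, z₁⟩ := typeSet_binaryReduction_signWord (signSet 1 ∪ {-1})
  obtain ⟨o₂, z₂⟩ := typeSet_binaryReduction_signWord (signSet 1)
  -- Since `-1` is odd, the types `a` and `c` do not depend on the choice made there, so this
  -- identity serves both words.
  have hc := even_diff_signSet_one
  rw [compl_signSet_one, even_inter_signSet_union] at hc
  rw [even_inter_signSet_union] at a₁
  rw [odd_inter_signSet_union] at b₁
  rw [compl_signSet_one_union] at c₁ d₁ z₁
  rw [compl_signSet_one, even_inter_signSet_union] at c₂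
  rw [compl_signSet_one, odd_inter_signSet_union] at d₂
  rw [compl_signSet_one] at z₂
  have hU₁ := odd_inter_signSet 1 odd_one
  have hU₃ := odd_inter_signSet 3 (by decide)
  have hV₁ : signSet 1 = ⋃ m : ℕ, residueClass (2 ^ (m + 2)) (2 ^ m - 1) := by
    simp only [signSet, one_mul]
  have hV₃ : signSet 3 = ⋃ m : ℕ, residueClass (2 ^ (m + 2)) (3 * 2 ^ m - 1) := rfl
  simp only [one_mul] at hU₁
  refine ⟨signWord (signSet 1 ∪ {-1}), signWord (signSet 1), fun h => ?_, setOf_fixed_eq, h₁,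
    signWord_zero hP₁, ?_, h₂, signWord_zero hP₂, ?_, ?_⟩
  · rw [h, h₂] at h₁
    exact absurd h₁ (by decide)
  · have := isLimitOfSeed_of_fixed hP₁.applySubst
    rwa [h₁, signWord_zero hP₁] at this
  · have := isLimitOfSeed_of_fixed hP₂.applySubst
    rwa [h₂, signWord_zero hP₂] at this
  refine ⟨a₁.trans even_inter_signSet_one, c₁.trans hc, by rw [b₁, hU₁], d₁.trans hU₃,
    a₂.trans even_inter_signSet_one, c₂.trans hc, b₂.trans hU₁, by rw [d₂, hU₃],
    fun x hx => ?_, ?_, fun x hx => ?_, ?_, fun w hw A B C D => ?_,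
    by rw [o₁, hV₁], z₁.trans hV₃, o₂.trans hV₁, by rw [z₂, hV₃], ?_, ?_, ?_, ?_, fun w hw h => ?_⟩
  · unfold pointSet
    cases x
    · rw [a₁]
      exact isRegularModelSet_even (Or.inl rfl)
    · rw [b₁]
      exact isRegularModelSet_odd_union (Or.inl rfl)
    · rw [c₁]
      exact isRegularModelSet_even (Or.inr rfl)
    · exact absurd rfl hx
  · rw [pointSet, d₁]
    exact isRegularModelSet_odd_diff (Or.inr rfl)
  · unfold pointSet
    cases x
    · rw [a₂]
      exact isRegularModelSet_even (Or.inl rfl)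
    · exact absurd rfl hx
    · rw [c₂]
      exact isRegularModelSet_even (Or.inr rfl)
    · rw [d₂]
      exact isRegularModelSet_odd_union (Or.inr rfl)
  · rw [pointSet, b₂]
    exact isRegularModelSet_odd_diff (Or.inl rfl)
  · obtain ⟨P, hP, rfl⟩ := isSignPattern_of_mem hw
    exact ⟨hasDiffraction_signWord hP A B C D, isPurePointDiffractive_signWord hP A B C D⟩
  · rw [pointSet, o₁]
    exact isRegularModelSet_signSet_union (Or.inl rfl)
  · rw [pointSet, z₁]
    exact isRegularModelSet_signSet_diff (Or.inr rfl)
  · rw [pointSet, z₂]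
    exact isRegularModelSet_signSet_union (Or.inr rfl)
  · rw [pointSet, o₂]
    exact isRegularModelSet_signSet_diff (Or.inl rfl)
  · obtain ⟨P, hP, rfl⟩ := isSignPattern_of_mem hw
    rw [combWeight_binaryReduction]
    exact ⟨hasDiffraction_signWord hP _ _ _ _, isPurePointDiffractive_signWord hP _ _ _ _⟩
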